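/- Consider finite directed acyclic expression graphs whose leaves are uniform inputs $U_1,\dots,U_k$, real parameters $\theta_1,\dots,\theta_m$ and fixed real constants, and whose internal nodes are operators from \[ \mathcal F=\{+,-,\times,/,\bmod,\operatorname{round},|\cdot|,\operatorname{sign},\lfloor\cdot\rfloor,\lceil\cdot\rceil,\sin,\cos,\exp,\log,\tan,\arctan\} \] applied to other nodes; a node may be used any number of times. A parametric family $(P_\theta)_{\theta\in\Theta}$, $\Theta\subseteq\mathbb R^m$, of probability distributions on $\mathbb R^d$ has an *extended one-liner* if there are an integer $k$ and one such graph with $d$ designated output nodes, neither depending on $\theta$, such that for every $\theta\in\Theta$ all operators of the graph are applied inside their natural domains for all inputs in $(0,1)^k$, and, for $U_1,\dots,U_k$ i.i.d. uniform on $(0,1)$, the vector $T(U_1,\dots,U_k,\theta)$ of outputs has law exactly $P_\theta$. For every $d\ge 1$, the family $\operatorname{Dirichlet}(\alpha_1,\dots,\alpha_d)$, with parameter $\alpha=(\alpha_1,\dots,\alpha_d)\in(0,1)^d$, has an extended one-liner. Here $\operatorname{Dirichlet}(\alpha_1,\dots,\alpha_d)$ is the law of $(X_1,\dots,X_d)$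 with $X_d=1-X_1-\dots-X_{d-1}$, where $(X_1,\dots,X_{d-1})$ has the density \[ \frac{\Gamma(\alpha_1+\dots+\alpha_d)}{\Gamma(\alpha_1)\cdots\Gamma(\alpha_d)}\;x_1^{\alpha_1-1}\cdots x_{d-1}^{\alpha_{d-1}-1}\,(1-x_1-\dots-x_{d-1})^{\alpha_d-1} \] on $\{x_1,\dots,x_{d-1}>0,\ x_1+\dots+x_{d-1}<1\}$ (for $d=1$ it is the point mass at $1$). -/

import Mathlib

open MeasureTheory ProbabilityTheory
open scoped ENNReal

namespace OneLiner

/-- The admissible unary operators. -/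
inductive UnOp where
  | round | abs | sign | floor | ceil | sin | cos | exp | log | tan | arctan

/-- The admissible binary operators. -/
inductive BinOp where
  | add | sub | mul | div | mod

/-- The real function denoted by a unary operator. -/
noncomputable def UnOp.eval : UnOp → ℝ → ℝ
  | .round, x => ((_root_.round x : ℤ) : ℝ)
  | .abs, x => |x|
  | .sign, x => Real.sign x
  | .floor, x => ((⌊x⌋ : ℤ) : ℝ)
  | .ceil, x => ((⌈x⌉ : ℤ) : ℝ)
  | .sin, x => Real.sin x
  | .cos, x => Real.cos x
  | .exp, x => Real.exp x
  | .log, x => Real.log x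
  | .tan, x => Real.tan x
  | .arctan, x => Real.arctan x

/-- The natural domain of a unary operator. -/
def UnOp.Dom : UnOp → ℝ → Prop
  | .log, x => 0 < x
  | .tan, x => Real.cos x ≠ 0
  | _, _ => True

/-- The real function denoted by a binary operator; `x mod y = x - y * ⌊x / y⌋`. -/
noncomputable def BinOp.eval : BinOp → ℝ → ℝ → ℝ
  | .add, x, y => x + y
  | .sub, x, y => x - y
  | .mul, x, y => x * y
  | .div, x, y => x / y
  | .mod, x, y => x - y * ((⌊x / y⌋ : ℤ) : ℝ)

/-- The natural domain of a binary operator. -/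
def BinOp.Dom : BinOp → ℝ → ℝ → Prop
  | .div, _, y => y ≠ 0
  | .mod, _, y => y ≠ 0
  | _, _, _ => True

/-- A node of an expression graph with `k` uniform inputs and `m` parameters, which comes after
`N` earlier nodes: a leaf, or an operator applied to earlier nodes. A constant is a fixed real
number, which cannot depend on the parameters. -/
inductive Node (k m N : ℕ) where
  | unif (i : Fin k)
  | param (j : Fin m)
  | const (c : ℝ)
  | un (f : UnOp) (a : Fin N)
  | bin (f : BinOp) (a b : Fin N)

/-- The value of a node, given the uniform inputs `u`, the parameters `θ` and the values `v` of
the earlier nodes. -/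
noncomputable def Node.eval {k m N : ℕ} (u : Fin k → ℝ) (θ : Fin m → ℝ) (v : Fin N → ℝ) :
    Node k m N → ℝ
  | .unif i => u i
  | .param j => θ j
  | .const c => c
  | .un f a => f.eval (v a)
  | .bin f a b => f.eval (v a) (v b)

/-- The operator at the node is applied inside its natural domain. -/
def Node.Defined {k m N : ℕ} (v : Fin N → ℝ) : Node k m N → Prop
  | .un f a => f.Dom (v a)
  | .bin f a b => f.Dom (v a) (v b)
  | _ => True

/-- A finite directed acyclic expression graph, its `N` nodes being listed so that the arguments
of every operator come before it. A node may be used any number of times. -/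
inductive Dag (k m : ℕ) : ℕ → Type where
  | nil : Dag k m 0
  | snoc {N : ℕ} (D : Dag k m N) (a : Node k m N) : Dag k m (N + 1)

/-- The values of all nodes of the graph. -/
noncomputable def Dag.eval {k m : ℕ} (u : Fin k → ℝ) (θ : Fin m → ℝ) :
    {N : ℕ} → Dag k m N → Fin N → ℝ
  | _, .nil => fun i => i.elim0
  | _, .snoc D a => Fin.snoc (α := fun _ => ℝ) (D.eval u θ) (a.eval u θ (D.eval u θ))

/-- Every operator of the graph is applied inside its natural domain (no division by zero, no
logarithm of a number that is not positive, ...). -/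
def Dag.Defined {k m : ℕ} (u : Fin k → ℝ) (θ : Fin m → ℝ) : {N : ℕ} → Dag k m N → Prop
  | _, .nil => True
  | _, .snoc D a => D.Defined u θ ∧ a.Defined (D.eval u θ)

/-- The joint law of `k` independent uniform random variables on the open interval `(0, 1)`. -/
noncomputable def uniformCube (k : ℕ) : Measure (Fin k → ℝ) :=
  Measure.pi fun _ => volume.restrict (Set.Ioo (0 : ℝ) 1)

/-- The family `P θ`, `θ ∈ Θ`, of laws on `ℝ ^ d` has an extended one-liner: there are a number `k`
of uniforms and one expression graph with `d` designated output nodes, both not depending on `θ`,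
such that for every `θ ∈ Θ` the graph is well defined on `(0, 1) ^ k` and its outputs have law
`P θ` when the inputs are i.i.d. uniform on `(0, 1)`. -/
def HasExtendedOneLiner {m d : ℕ} (Θ : Set (Fin m → ℝ))
    (P : (Fin m → ℝ) → Measure (Fin d → ℝ)) : Prop :=
  ∃ (k N : ℕ) (D : Dag k m N) (out : Fin d → Fin N), ∀ θ ∈ Θ,
    (∀ u : Fin k → ℝ, (∀ i, u i ∈ Set.Ioo (0 : ℝ) 1) → D.Defined u θ) ∧
    HasLaw (fun u j => D.eval u θ (out j)) (P θ) (uniformCube k)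

/-- The density of the first `n` coordinates of the Dirichlet distribution with parameters
`α 0, …, α n`:
`Γ(∑ α i) / ∏ Γ(α i) * ∏ (i < n), x i ^ (α i - 1) * (1 - ∑ x i) ^ (α n - 1)`
where all `x i > 0` and `∑ x i < 1`, and `0` elsewhere. -/
noncomputable def dirichletPDF {n : ℕ} (α : Fin (n + 1) → ℝ) : (Fin n → ℝ) → ℝ≥0∞ :=
  Set.indicator {x | (∀ i, 0 < x i) ∧ ∑ i, x i < 1} fun x =>
    ENNReal.ofReal (Real.Gamma (∑ i, α i) / (∏ i, Real.Gamma (α i)) *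
      ((∏ i : Fin n, x i ^ (α i.castSucc - 1)) * (1 - ∑ i, x i) ^ (α (Fin.last n) - 1)))

/-- The Dirichlet distribution with parameters `α 0, …, α n`, as a law on `ℝ ^ (n + 1)`: the first
`n` coordinates have density `dirichletPDF α`, and the last one is `1` minus their sum. -/
noncomputable def dirichletMeasure {n : ℕ} (α : Fin (n + 1) → ℝ) : Measure (Fin (n + 1) → ℝ) :=
  (volume.withDensity (dirichletPDF α)).map fun x =>
    Fin.snoc (α := fun _ => ℝ) x (1 - ∑ i, x i)

end OneLiner

/-! Only two properties of the Dirichlet family matter: its density is jointly continuous in the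
parameter and the point on an open set of nonnegative points, and it integrates to 1. No special
sampling algorithm is used; the strength comes from the fixed real constants, each of which can hold
infinitely many digits.

Discrete side: every function ℕ → ℕ, however complicated, is an expression (`NatExpressible.table`).
Its values are stored as digits of one real constant and read off with powers of 2 and floors.
Reading needs an a priori bound on the values, and such bounds, growing arbitrarily fast, come from
reciprocals of fractional parts of `c * 2 ^ n` for sparse `c` (`exists_majorant`).

Geometric side: the region under the density is an open set `O` whose fibre over each parameter θ
has volume 1. A uniform point of the fibre, with its height forgotten, has the required law
(`map_tail_restrict_subgraph`). Each fibre is exhausted, up to a null set, by disjoint dyadic cubes,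
those of stage `j` having total volume `2 ^ (-(j + 1))`. One uniform selects a cube with probability
equal to its volume, and the others select a point in it (`hasLaw_sampler`).

Link: the cubes are chosen so that the selected one depends on θ and the first uniform only through
finitely many natural numbers (a compactness level of θ, the stage, the position, and the dyadic
cell of θ), so it is a table lookup (`exists_expressible_hasLaw_restrict`). Compactness of the
parameter cells makes one dyadic resolution serve all θ of a given level (`exists_levels`). -/

namespace OneLiner

/-! ### Calculus of functions computed by expression graphs -/

section

variable {k m : ℕ} {S : Set ((Fin k → ℝ) × (Fin m → ℝ))} {f g : (Fin k → ℝ) × (Fin m → ℝ) → ℝ}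

/-- `f` can be computed on `S` by adding nodes to any graph that is well defined on `S`. -/
def Expressible (S : Set ((Fin k → ℝ) × (Fin m → ℝ))) (f : (Fin k → ℝ) × (Fin m → ℝ) → ℝ) : Prop :=
  ∀ (N : ℕ) (D : Dag k m N), (∀ s ∈ S, D.Defined s.1 s.2) →
    ∃ (N' : ℕ) (D' : Dag k m N') (ι : Fin N → Fin N') (o : Fin N'),
      (∀ s ∈ S, D'.Defined s.1 s.2) ∧ (∀ s ∈ S, ∀ i, D'.eval s.1 s.2 (ι i) = D.eval s.1 s.2 i) ∧
      ∀ s ∈ S, D'.eval s.1 s.2 o = f s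

theorem Expressible.congr (hf : Expressible S f) (h : ∀ s ∈ S, f s = g s) : Expressible S g := by
  intro N D hD
  obtain ⟨N', D', ι, o, h1, h2, h3⟩ := hf N D hD
  exact ⟨N', D', ι, o, h1, h2, fun s hs => (h3 s hs).trans (h s hs)⟩

theorem Expressible.of_leaf (a : ∀ N, Node k m N)
    (hd : ∀ N (v : Fin N → ℝ), (a N).Defined v)
    (he : ∀ N, ∀ s ∈ S, ∀ v : Fin N → ℝ, (a N).eval s.1 s.2 v = f s) : Expressible S f := by
  intro N D hD
  refine ⟨N + 1, D.snoc (a N), Fin.castSucc, Fin.last N, fun s hs => ⟨hD s hs, hd N _⟩,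
    fun s hs i => ?_, fun s hs => ?_⟩
  · simp [Dag.eval]
  · simp [Dag.eval, he N s hs]

theorem Expressible.unif (i : Fin k) : Expressible S fun s => s.1 i :=
  .of_leaf (fun _ => .unif i) (fun _ _ => trivial) fun _ _ _ _ => rfl

theorem Expressible.param (j : Fin m) : Expressible S fun s => s.2 j :=
  .of_leaf (fun _ => .param j) (fun _ _ => trivial) fun _ _ _ _ => rfl

theorem Expressible.const (c : ℝ) : Expressible S fun _ => c :=
  .of_leaf (fun _ => .const c) (fun _ _ => trivial) fun _ _ _ _ => rfl

theorem Expressible.un (hf : Expressible S f) (op : UnOp) (hd : ∀ s ∈ S, op.Dom (f s)) :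
    Expressible S fun s => op.eval (f s) := by
  intro N D hD
  obtain ⟨N', D', ι, o, h1, h2, h3⟩ := hf N D hD
  refine ⟨N' + 1, D'.snoc (.un op o), fun i => (ι i).castSucc, Fin.last N',
    fun s hs => ⟨h1 s hs, ?_⟩, fun s hs i => ?_, fun s hs => ?_⟩
  · simpa [Node.Defined, h3 s hs] using hd s hs
  · simp [Dag.eval, h2 s hs]
  · simp [Dag.eval, Node.eval, h3 s hs]

theorem Expressible.bin (hf : Expressible S f) (hg : Expressible S g) (op : BinOp)
    (hd : ∀ s ∈ S, op.Dom (f s) (g s)) : Expressible S fun s => op.eval (f s) (g s) := by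
  intro N D hD
  obtain ⟨N', D', ι, o, h1, h2, h3⟩ := hf N D hD
  obtain ⟨N'', D'', ι', o', h1', h2', h3'⟩ := hg N' D' h1
  refine ⟨N'' + 1, D''.snoc (.bin op (ι' o) o'), fun i => (ι' (ι i)).castSucc, Fin.last N'',
    fun s hs => ⟨h1' s hs, ?_⟩, fun s hs i => ?_, fun s hs => ?_⟩
  · simpa [Node.Defined, h2' s hs, h3 s hs, h3' s hs] using hd s hs
  · simp [Dag.eval, h2 s hs, h2' s hs]
  · simp [Dag.eval, Node.eval, h2' s hs, h3 s hs, h3' s hs]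

theorem Expressible.add (hf : Expressible S f) (hg : Expressible S g) :
    Expressible S fun s => f s + g s := hf.bin hg .add fun _ _ => trivial

theorem Expressible.sub (hf : Expressible S f) (hg : Expressible S g) :
    Expressible S fun s => f s - g s := hf.bin hg .sub fun _ _ => trivial

theorem Expressible.mul (hf : Expressible S f) (hg : Expressible S g) :
    Expressible S fun s => f s * g s := hf.bin hg .mul fun _ _ => trivial

theorem Expressible.div (hf : Expressible S f) (hg : Expressible S g) (h0 : ∀ s ∈ S, g s ≠ 0) :
    Expressible S fun s => f s / g s := hf.bin hg .div h0

theorem Expressible.fract (hf : Expressible S f) : Expressible S fun s => Int.fract (f s) :=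
  (hf.bin (.const 1) .mod fun _ _ => one_ne_zero).congr fun s _ => by
    simp [BinOp.eval]

theorem Expressible.sum {ι : Type*} (t : Finset ι) (F : ι → (Fin k → ℝ) × (Fin m → ℝ) → ℝ)
    (h : ∀ i, Expressible S (F i)) : Expressible S fun s => ∑ i ∈ t, F i s := by
  classical
  induction t using Finset.induction_on with
  | empty => simpa using Expressible.const 0
  | insert i t hi ih => simpa [Finset.sum_insert hi] using (h i).add ih

/-- A natural-valued function that can be computed on `S`. -/
def NatExpressible (S : Set ((Fin k → ℝ) × (Fin m → ℝ))) (f : (Fin k → ℝ) × (Fin m → ℝ) → ℕ) :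
    Prop :=
  Expressible S fun s => (f s : ℝ)

theorem Expressible.natFloor (hf : Expressible S f) (h0 : ∀ s ∈ S, 0 ≤ f s) :
    NatExpressible S fun s => ⌊f s⌋₊ :=
  (hf.un .floor fun _ _ => trivial).congr fun s hs => by
    simp only [UnOp.eval]
    exact (natCast_floor_eq_intCast_floor (h0 s hs)).symm

theorem Expressible.natCeil (hf : Expressible S f) (h0 : ∀ s ∈ S, 0 ≤ f s) :
    NatExpressible S fun s => ⌈f s⌉₊ :=
  (hf.un .ceil fun _ _ => trivial).congr fun s hs => by
    simp only [UnOp.eval]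
    exact (natCast_ceil_eq_intCast_ceil (h0 s hs)).symm

theorem Expressible.two_pow {a : (Fin k → ℝ) × (Fin m → ℝ) → ℕ} (ha : NatExpressible S a) :
    Expressible S fun s => (2 : ℝ) ^ a s :=
  ((ha.mul (.const (Real.log 2))).un .exp fun _ _ => trivial).congr fun s _ => by
    simp only [UnOp.eval]
    rw [Real.exp_nat_mul, Real.exp_log two_pos]

theorem Expressible.inv_two_pow {a : (Fin k → ℝ) × (Fin m → ℝ) → ℕ} (ha : NatExpressible S a) :
    Expressible S fun s => ((2 : ℝ) ^ a s)⁻¹ :=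
  ((Expressible.const 1).div (.two_pow ha) fun _ _ => by positivity).congr fun s _ => by simp

/-- Expressibility allows extending any given graph while keeping its old values, so the outputs can
be added one after another to a single graph. -/
theorem exists_dag_of_expressible {d : ℕ} (F : Fin d → (Fin k → ℝ) × (Fin m → ℝ) → ℝ)
    (hF : ∀ j, Expressible S (F j)) :
    ∃ (N : ℕ) (D : Dag k m N) (out : Fin d → Fin N), (∀ s ∈ S, D.Defined s.1 s.2) ∧
      ∀ s ∈ S, ∀ j, D.eval s.1 s.2 (out j) = F j s := by
  induction d with
  | zero => exact ⟨0, .nil, fun i => i.elim0, fun _ _ => trivial, fun _ _ i => i.elim0⟩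
  | succ d ih =>
    obtain ⟨N, D, out, h1, h2⟩ := ih (fun j => F j.castSucc) fun j => hF _
    obtain ⟨N', D', ι, o, h1', h2', h3'⟩ := hF (Fin.last d) N D h1
    refine ⟨N', D', Fin.snoc (α := fun _ => Fin N') (fun j => ι (out j)) o, h1', fun s hs j => ?_⟩
    refine Fin.lastCases ?_ (fun j => ?_) j
    · simp [h3' s hs]
    · simp [h2' s hs, h2 s hs]

end

/-! ### Arbitrary functions on ℕ stored in real constants -/

section

/-- A real number with prescribed digits `g i` in the mixed radix `b i`. -/
theorem exists_real_digits (b g : ℕ → ℕ) (h : ∀ i, g i + 2 ≤ b i) :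
    ∃ (c : ℝ) (C : ℕ → ℕ), C 0 = 0 ∧ (∀ i, C (i + 1) = C i * b i + g i) ∧
      ∀ i, (C i : ℝ) ≤ c * ∏ l ∈ Finset.range i, (b l : ℝ) ∧
        c * ∏ l ∈ Finset.range i, (b l : ℝ) < C i + 1 := by
  obtain ⟨C, hC0, hC⟩ : ∃ C : ℕ → ℕ, C 0 = 0 ∧ ∀ i, C (i + 1) = C i * b i + g i :=
    ⟨fun i => Nat.rec 0 (fun i x => x * b i + g i) i, rfl, fun _ => rfl⟩
  set B : ℕ → ℝ := fun i => ∏ l ∈ Finset.range i, (b l : ℝ) with hB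
  have hb : ∀ i, (g i : ℝ) + 2 ≤ b i := fun i => by exact_mod_cast h i
  have hb0 : ∀ i, (0 : ℝ) < b i := fun i => by
    have := hb i
    have : (0 : ℝ) ≤ g i := Nat.cast_nonneg _
    linarith
  have hBpos : ∀ i, 0 < B i := fun i => Finset.prod_pos fun l _ => hb0 l
  have hBs : ∀ i, B (i + 1) = B i * b i := fun i => Finset.prod_range_succ _ _
  have hCs : ∀ i, (C (i + 1) : ℝ) = (C i : ℝ) * b i + g i := fun i => by rw [hC]; push_cast; rfl
  have hlo : Monotone fun i => (C i : ℝ) / B i := by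
    refine monotone_nat_of_le_succ fun i => ?_
    rw [div_le_div_iff₀ (hBpos _) (hBpos _), hBs, hCs]
    have : 0 ≤ B i * g i := mul_nonneg (hBpos i).le (Nat.cast_nonneg _)
    linarith
  -- Digits at most `b i - 2` make the upper ends strictly decrease, so the limit stays strictly
  -- below each of them and a floor recovers `C i` exactly.
  have hup : StrictAnti fun i => ((C i : ℝ) + 1) / B i := by
    refine strictAnti_nat_of_succ_lt fun i => ?_
    rw [div_lt_div_iff₀ (hBpos _) (hBpos _), hBs, hCs]
    nlinarith [hb i, hBpos i]
  have hlu : ∀ i l, (C i : ℝ) / B i ≤ ((C l : ℝ) + 1) / B l := fun i l =>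
    (hlo (le_max_left i l)).trans
      ((div_le_div_of_nonneg_right (le_add_of_nonneg_right zero_le_one) (hBpos _).le).trans
      (hup.antitone (le_max_right i l)))
  have hbdd : BddAbove (Set.range fun i => (C i : ℝ) / B i) :=
    ⟨((C 0 : ℝ) + 1) / B 0, by rintro _ ⟨i, rfl⟩; exact hlu i 0⟩
  refine ⟨⨆ i, (C i : ℝ) / B i, C, hC0, hC, fun i => ⟨?_, ?_⟩⟩
  · rw [← div_le_iff₀ (hBpos i)]
    exact le_ciSup hbdd i
  · rw [← lt_div_iff₀ (hBpos i)]
    exact (ciSup_le fun l => hlu l (i + 1)).trans_lt (hup (Nat.lt_succ_self i))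

theorem exists_le_lt_succ {t : ℕ → ℕ} (ht : StrictMono t) (h0 : t 0 = 0) (n : ℕ) :
    ∃ i, t i ≤ n ∧ n < t (i + 1) := by
  have hex : ∃ l, n < t l := ⟨n + 1, (Nat.lt_succ_self n).trans_le (ht.id_le _)⟩
  obtain ⟨l, hl⟩ : ∃ l, Nat.find hex = l + 1 := by
    refine Nat.exists_eq_succ_of_ne_zero fun h => ?_
    have := Nat.find_spec hex
    rw [h, h0] at this
    omega
  refine ⟨l, not_lt.1 (Nat.find_min hex (by omega)), ?_⟩
  rw [← hl]
  exact Nat.find_spec hex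

/-- A real number with binary digits so sparse that, for `t i ≤ n < t (i + 1)`, the fractional part
of `c * 2 ^ n` is at most `1 / (t (i + 1) - n)`. -/
theorem exists_real_sparse (t : ℕ → ℕ) (h0 : t 0 = 0) (ht : ∀ i, t i + 2 ≤ t (i + 1)) :
    ∃ c : ℝ, ∀ n, 0 < Int.fract (c * 2 ^ n) ∧ ∀ i, t i ≤ n → n < t (i + 1) →
      (t (i + 1) : ℝ) - n ≤ 1 / Int.fract (c * 2 ^ n) := by
  obtain ⟨c, C, hC0, hC, hc⟩ := exists_real_digits (fun i => 2 ^ (t (i + 1) - t i)) (fun _ => 1)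
    fun i => by
      calc 1 + 2 ≤ 2 ^ 2 := by norm_num
        _ ≤ _ := Nat.pow_le_pow_right two_pos (by have := ht i; omega)
  have hB : ∀ i, ∏ l ∈ Finset.range i, ((2 ^ (t (l + 1) - t l) : ℕ) : ℝ) = 2 ^ t i := by
    intro i
    induction i with
    | zero => simp [h0]
    | succ i ih =>
      rw [Finset.prod_range_succ, ih]
      push_cast
      rw [← pow_add]
      congr 1
      have := ht i
      omega
  simp only [hB] at hc
  have key : ∀ n i, t i ≤ n → n < t (i + 1) → 0 < Int.fract (c * 2 ^ n) ∧
      (t (i + 1) : ℝ) - n ≤ 1 / Int.fract (c * 2 ^ n) := by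
    intro n i h1 h2
    obtain ⟨e, he⟩ := Nat.exists_eq_add_of_le h1
    obtain ⟨r, hr⟩ := Nat.exists_eq_add_of_lt h2
    have hs := hc (i + 1)
    have hti : t (i + 1) - t i = e + r + 1 := by omega
    have hpow : (2 : ℝ) ^ t (i + 1) = 2 ^ n * 2 ^ (r + 1) := by rw [hr, ← pow_add]; rfl
    have hCs : (C (i + 1) : ℝ) = C i * 2 ^ e * 2 ^ (r + 1) + 1 := by
      rw [hC, hti, add_assoc, pow_add]
      push_cast
      ring
    rw [hpow, hCs, ← mul_assoc] at hs
    have hr1 : (r : ℝ) + 1 ≤ 2 ^ r := by exact_mod_cast Nat.lt_two_pow_self (n := r)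
    have hrp : (0 : ℝ) < 2 ^ r := by positivity
    rw [pow_succ] at hs
    -- With `r + 1 = t (i + 1) - n`, the only digit in the block is its last one, so `y * 2 ^ (r +
    -- 1)` lies in `[1, 2)`. Hence `y` is the fractional part and `1 / y > 2 ^ r ≥ r + 1`.
    set y : ℝ := c * 2 ^ n - C i * 2 ^ e with hy
    have hy1 : 1 ≤ y * (2 ^ r * 2) := by rw [hy]; linarith [hs.1]
    have hy2 : y * (2 ^ r * 2) < 2 := by rw [hy]; linarith [hs.2]
    have hy0 : 0 < y := by
      by_contra hneg
      have := mul_nonneg (sub_nonneg.2 (not_lt.1 hneg)) hrp.le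
      nlinarith
    have hyr : y * 2 ^ r < 1 := by linarith
    have hyl : y < 1 := by
      have hr2 : (1 : ℝ) ≤ 2 ^ r := one_le_pow₀ one_le_two
      nlinarith [mul_le_mul_of_nonneg_left hr2 hy0.le]
    have hfr : Int.fract (c * 2 ^ n) = y := by
      rw [Int.fract_eq_iff]
      exact ⟨hy0.le, hyl, (C i * 2 ^ e : ℕ), by rw [hy]; push_cast; ring⟩
    rw [hfr]
    refine ⟨hy0, ?_⟩
    rw [le_div_iff₀ hy0, hr]
    push_cast
    nlinarith
  refine ⟨c, fun n => ?_⟩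
  obtain ⟨i, h1, h2⟩ := exists_le_lt_succ
    (strictMono_nat_of_lt_succ fun i => by have := ht i; omega) h0 n
  exact ⟨(key n i h1 h2).1, fun i h1 h2 => (key n i h1 h2).2⟩

/-- A sparse constant bounds the distance from `n` to its next breakpoint, which is useless just
before a breakpoint. Two constants with interleaved breakpoints cure this: if `w l ≤ n < w (l + 1)`,
one of them has `w (l + 2)` as its next breakpoint, and the gaps of `w` are large enough to absorb
`G n`. -/
theorem exists_majorant (G : ℕ → ℕ) : ∃ c₀ c₁ : ℝ, ∀ n,
    0 < Int.fract (c₀ * 2 ^ n) ∧ 0 < Int.fract (c₁ * 2 ^ n) ∧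
      (G n : ℝ) ≤ 1 / Int.fract (c₀ * 2 ^ n) + 1 / Int.fract (c₁ * 2 ^ n) := by
  obtain ⟨w, hw0, hw⟩ : ∃ w : ℕ → ℕ, w 0 = 0 ∧
      ∀ i, w (i + 1) = w i + ∑ n ∈ Finset.range (w i + 1), G n + 2 :=
    ⟨fun i => Nat.rec 0 (fun _ x => x + ∑ n ∈ Finset.range (x + 1), G n + 2) i, rfl, fun _ => rfl⟩
  have hw2 : ∀ i, w i + 2 ≤ w (i + 1) := fun i => by rw [hw]; omega
  -- The breakpoints of odd index, preceded by 0 since a sequence of breakpoints must start there.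
  let t : ℕ → ℕ := fun i => Nat.casesOn i 0 fun i => w (2 * i + 1)
  obtain ⟨c₀, h₀⟩ := exists_real_sparse (fun i => w (2 * i)) hw0 fun i =>
    (hw2 (2 * i)).trans ((Nat.le_add_right _ 2).trans (hw2 (2 * i + 1)))
  obtain ⟨c₁, h₁⟩ := exists_real_sparse t rfl fun i => by
    cases i with
    | zero => simpa [t, hw0] using hw2 0
    | succ i => exact (hw2 (2 * i + 1)).trans ((Nat.le_add_right _ 2).trans (hw2 (2 * i + 2)))
  refine ⟨c₀, c₁, fun n => ⟨(h₀ n).1, (h₁ n).1, ?_⟩⟩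
  have hmono : StrictMono w := strictMono_nat_of_lt_succ fun i => by have := hw2 i; omega
  obtain ⟨l, hl1, hl2⟩ := exists_le_lt_succ hmono hw0 n
  have hG : G n + n ≤ w (l + 2) := by
    rw [hw (l + 1)]
    have : G n ≤ ∑ i ∈ Finset.range (w (l + 1) + 1), G i :=
      Finset.single_le_sum (fun _ _ => Nat.zero_le _) (Finset.mem_range.2 (by omega))
    omega
  have hG' : (G n : ℝ) ≤ w (l + 2) - n := by
    rw [le_sub_iff_add_le]
    exact_mod_cast hG
  have p₀ : 0 < 1 / Int.fract (c₀ * 2 ^ n) := one_div_pos.2 (h₀ n).1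
  have p₁ : 0 < 1 / Int.fract (c₁ * 2 ^ n) := one_div_pos.2 (h₁ n).1
  have hlast : n < w (l + 2) := hl2.trans_le (hmono.monotone (Nat.le_succ (l + 1)))
  rcases Nat.even_or_odd' l with ⟨i, rfl | rfl⟩
  · have := (h₀ n).2 i hl1 hlast
    rw [mul_add] at this
    linarith
  · have : (w (2 * (i + 1) + 1) : ℝ) - n ≤ _ := (h₁ n).2 (i + 1) hl1 hlast
    have e : 2 * (i + 1) + 1 = 2 * i + 1 + 2 := by ring
    rw [e] at this
    linarith

variable {k m : ℕ} {S : Set ((Fin k → ℝ) × (Fin m → ℝ))}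
  {f f' : (Fin k → ℝ) × (Fin m → ℝ) → ℕ}

theorem NatExpressible.const (c : ℕ) : NatExpressible S fun _ => c := Expressible.const (c : ℝ)

theorem NatExpressible.add (hf : NatExpressible S f) (hf' : NatExpressible S f') :
    NatExpressible S fun s => f s + f' s :=
  (Expressible.add hf hf').congr fun s _ => by push_cast; rfl

theorem NatExpressible.mul (hf : NatExpressible S f) (hf' : NatExpressible S f') :
    NatExpressible S fun s => f s * f' s :=
  (Expressible.mul hf hf').congr fun s _ => by push_cast; rfl

theorem NatExpressible.exists_majorant (G : ℕ → ℕ) (hf : NatExpressible S f) :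
    ∃ h : (Fin k → ℝ) × (Fin m → ℝ) → ℕ, NatExpressible S h ∧ ∀ s, G (f s) ≤ h s := by
  obtain ⟨c₀, c₁, hc⟩ := OneLiner.exists_majorant G
  refine ⟨fun s => ⌊1 / Int.fract (c₀ * 2 ^ f s) + 1 / Int.fract (c₁ * 2 ^ f s)⌋₊, ?_,
    fun s => Nat.le_floor (hc _).2.2⟩
  refine Expressible.natFloor (.add ?_ ?_) fun s _ => ?_
  · exact .div (.const 1) (.fract (.mul (.const c₀) (.two_pow hf))) fun s _ => (hc _).1.ne'
  · exact .div (.const 1) (.fract (.mul (.const c₁) (.two_pow hf))) fun s _ => (hc _).2.1.ne'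
  · exact add_nonneg (one_div_pos.2 (hc _).1).le (one_div_pos.2 (hc _).2.1).le

/-- The bound allows digit blocks of the explicit lengths `2 * i + 1`. Block `i` then starts at the
binary place `i * i`, which an expression can compute, so the digit can be located and extracted. -/
theorem NatExpressible.table_of_le (g : ℕ → ℕ) (hg : ∀ q, g q ≤ q) (hf : NatExpressible S f) :
    NatExpressible S fun s => g (f s) := by
  obtain ⟨c, C, hC0, hC, hc⟩ := exists_real_digits (fun i => 2 ^ (2 * i + 1)) g fun i => by
    have h1 : i < 2 ^ i := Nat.lt_two_pow_self
    have h2 := hg i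
    have h3 : 2 ^ (2 * i + 1) = 2 ^ i * 2 ^ i * 2 := by ring
    rw [h3]
    nlinarith
  have hB : ∀ i, ∏ l ∈ Finset.range i, ((2 ^ (2 * l + 1) : ℕ) : ℝ) = 2 ^ (i * i) := by
    intro i
    induction i with
    | zero => simp
    | succ i ih =>
      rw [Finset.prod_range_succ, ih]
      push_cast
      rw [← pow_add]
      congr 1
      ring
  simp only [hB] at hc
  have hfl : ∀ i, ⌊c * 2 ^ (i * i)⌋₊ = C i := fun i =>
    (Nat.floor_eq_iff ((Nat.cast_nonneg _).trans (hc i).1)).2 (hc i)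
  have hfl' : ∀ a : (Fin k → ℝ) × (Fin m → ℝ) → ℕ, NatExpressible S a →
      NatExpressible S fun s => ⌊c * 2 ^ (a s * a s)⌋₊ := fun a ha =>
    Expressible.natFloor (.mul (.const c) (.two_pow (ha.mul ha))) fun s _ =>
      (Nat.cast_nonneg _).trans (hc _).1
  -- The digit is read as `g q = C (q + 1) - C q * 2 ^ (2 * q + 1)`.
  refine Expressible.congr (.sub (hfl' _ (hf.add (.const 1))) (.mul (hfl' _ hf)
    (.two_pow (((NatExpressible.const 2).mul hf).add (.const 1))))) fun s _ => ?_
  simp only [hfl, hC]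
  push_cast
  ring

/-- Every function `ℕ → ℕ` can be computed, as it can be stored in finitely many constants. -/
theorem NatExpressible.table (g : ℕ → ℕ) (hf : NatExpressible S f) :
    NatExpressible S fun s => g (f s) := by
  obtain ⟨h, hh, hle⟩ := hf.exists_majorant g
  have hq : NatExpressible S fun s => (f s + h s) * (f s + h s) + f s :=
    ((hf.add hh).mul (hf.add hh)).add hf
  -- The code `q = (f + h) ^ 2 + f` determines `f` as `q` minus the square of its integer root, and
  -- `q ≥ h ≥ g f`. So truncating by `q` fits the bounded case without changing the value at such
  -- codes.
  refine (hq.table_of_le (fun q => min q (g (q - Nat.sqrt q * Nat.sqrt q)))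
    fun q => min_le_left _ _).congr fun s _ => ?_
  beta_reduce
  have h1 : f s ≤ f s + h s + (f s + h s) := by omega
  rw [Nat.sqrt_add_eq _ h1, Nat.add_sub_cancel_left, min_eq_right]
  nlinarith [hle s, Nat.zero_le (f s), Nat.le_mul_self (f s + h s)]

/-- The pairing `(a, b) ↦ (a + b) ^ 2 + a` is polynomial, hence expressible, and is inverted inside
the table by an integer square root. -/
theorem NatExpressible.table₂ (g : ℕ → ℕ → ℕ) (hf : NatExpressible S f)
    (hf' : NatExpressible S f') : NatExpressible S fun s => g (f s) (f' s) := by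
  refine ((((hf.add hf').mul (hf.add hf')).add hf).table
    (fun q => g (q - Nat.sqrt q * Nat.sqrt q)
      (Nat.sqrt q - (q - Nat.sqrt q * Nat.sqrt q)))).congr fun s _ => ?_
  beta_reduce
  rw [Nat.sqrt_add_eq _ (by omega), Nat.add_sub_cancel_left, Nat.add_sub_cancel_left]

theorem NatExpressible.table_pi {r : ℕ} (g : (Fin r → ℕ) → ℕ)
    {F : Fin r → (Fin k → ℝ) × (Fin m → ℝ) → ℕ} (hF : ∀ i, NatExpressible S (F i)) :
    NatExpressible S fun s => g fun i => F i s := by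
  induction r with
  | zero =>
    exact (NatExpressible.const (g 0)).congr fun s _ => by
      beta_reduce
      rw [Subsingleton.elim (fun i => F i s) 0]
  | succ r ih =>
    have h := ih (fun v => Encodable.encode v) fun i => hF i.succ
    refine ((hF 0).table₂ (fun a b => g (Fin.cons a ((Encodable.decode b).getD 0))) h).congr
      fun s _ => ?_
    simp only [Encodable.encodek, Option.getD_some]
    congr 2
    exact funext fun i => by refine Fin.cases ?_ (fun i => ?_) i <;> rfl

end

/-! ### Dyadic inner approximation of the fibres of an open set, uniformly in the parameter -/

section

/-- The index of the dyadic cube of side `2 ^ (-N)` which contains `x`. -/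
noncomputable def dyadicIndex {r : ℕ} (N : ℕ) (x : Fin r → ℝ) : Fin r → ℕ :=
  fun i => ⌊2 ^ N * x i⌋₊

/-- The half-open dyadic cube of side `2 ^ (-N)` with index `c`. -/
def dyadicCube {r : ℕ} (N : ℕ) (c : Fin r → ℕ) : Set (Fin r → ℝ) :=
  Set.univ.pi fun i => Set.Ico ((c i : ℝ) / 2 ^ N) ((c i + 1) / 2 ^ N)

variable {r d m : ℕ}

theorem mem_dyadicCube {N : ℕ} {c : Fin r → ℕ} {x : Fin r → ℝ} :
    x ∈ dyadicCube N c ↔ (∀ i, 0 ≤ x i) ∧ dyadicIndex N x = c := by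
  have h2 : (0 : ℝ) < 2 ^ N := by positivity
  simp only [dyadicCube, Set.mem_univ_pi, Set.mem_Ico, div_le_iff₀ h2, lt_div_iff₀ h2,
    funext_iff, dyadicIndex, mul_comm _ ((2 : ℝ) ^ N)]
  constructor
  · intro h
    have h0 : ∀ i, 0 ≤ 2 ^ N * x i := fun i => (Nat.cast_nonneg _).trans (h i).1
    exact ⟨fun i => nonneg_of_mul_nonneg_right (h0 i) h2,
      fun i => (Nat.floor_eq_iff (h0 i)).2 (h i)⟩
  · exact fun h i => (Nat.floor_eq_iff (mul_nonneg h2.le (h.1 i))).1 (h.2 i)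

theorem abs_sub_le_of_dyadicIndex_eq {N : ℕ} {x y : Fin r → ℝ} (hx : ∀ i, 0 ≤ x i)
    (hy : ∀ i, 0 ≤ y i) (h : dyadicIndex N x = dyadicIndex N y) (i : Fin r) :
    |x i - y i| < (1 / 2) ^ N := by
  have h2 : (0 : ℝ) < 2 ^ N := by positivity
  have hi : ⌊2 ^ N * x i⌋₊ = ⌊2 ^ N * y i⌋₊ := congrFun h i
  have a1 := Nat.floor_le (mul_nonneg h2.le (hx i))
  have a2 := Nat.lt_floor_add_one (2 ^ N * x i)
  have b1 := Nat.floor_le (mul_nonneg h2.le (hy i))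
  have b2 := Nat.lt_floor_add_one (2 ^ N * y i)
  rw [hi] at a1 a2
  have hmul := abs_mul (x i - y i) (2 ^ N)
  rw [abs_of_pos h2] at hmul
  rw [one_div, inv_pow, ← one_div, lt_div_iff₀ h2, ← hmul, abs_lt]
  constructor <;> linarith

theorem dyadicIndex_eq_of_le {N N' : ℕ} (hN : N ≤ N') {x y : Fin r → ℝ}
    (h : dyadicIndex N' x = dyadicIndex N' y) : dyadicIndex N x = dyadicIndex N y := by
  have key : ∀ z : Fin r → ℝ, ∀ i, dyadicIndex N z i = dyadicIndex N' z i / 2 ^ (N' - N) := by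
    intro z i
    simp only [dyadicIndex]
    rw [← Nat.floor_div_natCast]
    congr 1
    have : (2 : ℝ) ^ N' = 2 ^ N * 2 ^ (N' - N) := by rw [← pow_add]; congr 1; omega
    rw [this]
    push_cast
    field_simp
  funext i
  rw [key, key, h]

theorem measurableSet_dyadicCube (N : ℕ) (c : Fin r → ℕ) : MeasurableSet (dyadicCube N c) :=
  .univ_pi fun _ => measurableSet_Ico

theorem volume_dyadicCube (N : ℕ) (c : Fin r → ℕ) :
    volume (dyadicCube N c) = ((2 : ℝ≥0∞) ^ (N * r))⁻¹ := by
  have : ∀ i, ((c i : ℝ) + 1) / 2 ^ N - c i / 2 ^ N = (2 ^ N)⁻¹ := fun i => by ring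
  rw [dyadicCube, Real.volume_pi_Ico]
  simp only [this, Finset.prod_const, Finset.card_univ, Fintype.card_fin]
  rw [ENNReal.ofReal_inv_of_pos (by positivity), ENNReal.ofReal_pow two_pos.le, ENNReal.ofReal_ofNat,
    ← ENNReal.inv_pow, pow_mul]

theorem disjoint_dyadicCube {N : ℕ} {c c' : Fin r → ℕ} (h : c ≠ c') :
    Disjoint (dyadicCube N c) (dyadicCube N c') :=
  Set.disjoint_left.2 fun _ hz hz' =>
    h ((mem_dyadicCube.1 hz).2.symm.trans (mem_dyadicCube.1 hz').2)

theorem dyadicCube_subset_or_disjoint {N N' : ℕ} (hN : N ≤ N') (c' c : Fin r → ℕ) :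
    dyadicCube N' c' ⊆ dyadicCube N c ∨ Disjoint (dyadicCube N' c') (dyadicCube N c) := by
  refine or_iff_not_imp_right.2 fun h z hz => ?_
  obtain ⟨w, hw, hwc⟩ := Set.not_disjoint_iff.1 h
  rw [mem_dyadicCube] at hz hw hwc ⊢
  exact ⟨hz.1, (dyadicIndex_eq_of_le hN (hz.2.trans hw.2.symm)).trans hwc.2⟩

/-- The union of finitely many dyadic cubes of side `2 ^ (-N)`. -/
def dyadicUnion (N : ℕ) (s : Finset (Fin r → ℕ)) : Set (Fin r → ℝ) := ⋃ c ∈ s, dyadicCube N c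

theorem measurableSet_dyadicUnion (N : ℕ) (s : Finset (Fin r → ℕ)) :
    MeasurableSet (dyadicUnion N s) :=
  .biUnion s.countable_toSet fun c _ => measurableSet_dyadicCube N c

theorem volume_inter_dyadicUnion (N : ℕ) (s : Finset (Fin r → ℕ)) {B : Set (Fin r → ℝ)}
    (hB : MeasurableSet B) :
    volume (B ∩ dyadicUnion N s) = ∑ c ∈ s, volume (B ∩ dyadicCube N c) := by
  rw [dyadicUnion, Set.inter_iUnion₂]
  refine measure_biUnion_finset (fun c _ c' _ h => ?_) fun c _ =>
    hB.inter (measurableSet_dyadicCube N c)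
  exact (disjoint_dyadicCube h).mono Set.inter_subset_right Set.inter_subset_right

theorem volume_dyadicUnion (N : ℕ) (s : Finset (Fin r → ℕ)) :
    volume (dyadicUnion N s) = s.card * ((2 : ℝ≥0∞) ^ (N * r))⁻¹ := by
  have := volume_inter_dyadicUnion N s MeasurableSet.univ
  simpa [volume_dyadicCube] using this

open Classical in
/-- The indices of the dyadic cubes `Q` of side `2 ^ (-N)`, inside `[0, 2 ^ N) ^ d`, such that `O`
contains `C × Q`, where `C` is the dyadic cube of side `2 ^ (-N)` with index `p`. -/
noncomputable def goodCubes (O : Set ((Fin m → ℝ) × (Fin d → ℝ))) (N : ℕ) (p : Fin m → ℕ) :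
    Finset (Fin d → ℕ) :=
  (Fintype.piFinset fun _ => Finset.range (4 ^ N)).filter fun c =>
    ∀ θ : Fin m → ℝ, (∀ i, 0 ≤ θ i) → dyadicIndex N θ = p → ∀ z ∈ dyadicCube N c, (θ, z) ∈ O

variable {O : Set ((Fin m → ℝ) × (Fin d → ℝ))}

theorem mem_goodCubes {N : ℕ} {p : Fin m → ℕ} {c : Fin d → ℕ} :
    c ∈ goodCubes O N p ↔ (∀ i, c i < 4 ^ N) ∧ ∀ θ : Fin m → ℝ, (∀ i, 0 ≤ θ i) →
      dyadicIndex N θ = p → ∀ z ∈ dyadicCube N c, (θ, z) ∈ O := by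
  simp [goodCubes]

theorem dyadicUnion_goodCubes_subset {N : ℕ} {θ : Fin m → ℝ} (hθ : ∀ i, 0 ≤ θ i) {z : Fin d → ℝ}
    (hz : z ∈ dyadicUnion N (goodCubes O N (dyadicIndex N θ))) : (θ, z) ∈ O := by
  simp only [dyadicUnion, Set.mem_iUnion₂] at hz
  obtain ⟨c, hc, hz⟩ := hz
  exact (mem_goodCubes.1 hc).2 θ hθ rfl z hz

/-- Take a compact `C` in the fibre with volume above `ε`. The compact `{θ₀} × C` has a
`δ`-thickening inside `O`, so for θ within `δ / 2` of `θ₀` every dyadic cube meeting `C`, times the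
dyadic cell of θ, stays in `O` once the side is below `δ / 2`. -/
theorem exists_ball_lt_volume_goodCubes (hO : IsOpen O) {θ₀ : Fin m → ℝ}
    (hpos : ∀ z, (θ₀, z) ∈ O → ∀ i, 0 ≤ z i) {ε : ℝ≥0∞} (hε : ε < volume {z | (θ₀, z) ∈ O}) :
    ∃ δ > 0, ∃ N₀, ∀ N ≥ N₀, ∀ θ ∈ Metric.ball θ₀ δ, (∀ i, 0 ≤ θ i) →
      ε < volume (dyadicUnion N (goodCubes O N (dyadicIndex N θ))) := by
  have hOθ : IsOpen {z | (θ₀, z) ∈ O} := hO.preimage (by fun_prop)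
  obtain ⟨C, hCO, hC, hεC⟩ := hOθ.exists_lt_isCompact hε
  obtain ⟨δ, hδ, hthick⟩ := (isCompact_singleton (x := θ₀)).prod hC
    |>.exists_thickening_subset_open hO (by rintro ⟨a, z⟩ ⟨rfl, hz⟩; exact hCO hz)
  obtain ⟨R, hR⟩ := hC.isBounded.exists_norm_le
  obtain ⟨N₁, hN₁⟩ := exists_pow_lt_of_lt_one (half_pos hδ) (by norm_num : (1 / 2 : ℝ) < 1)
  obtain ⟨N₂, hN₂⟩ := pow_unbounded_of_one_lt R (one_lt_two (α := ℝ))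
  refine ⟨δ / 2, half_pos hδ, max N₁ N₂, fun N hN θ hθ hθ0 => hεC.trans_le (measure_mono ?_)⟩
  intro z hz
  have hz0 : ∀ i, 0 ≤ z i := hpos z (hCO hz)
  simp only [dyadicUnion, Set.mem_iUnion₂]
  refine ⟨dyadicIndex N z, mem_goodCubes.2 ⟨fun i => ?_, ?_⟩,
    mem_dyadicCube.2 ⟨hz0, rfl⟩⟩
  · rw [dyadicIndex, Nat.floor_lt (mul_nonneg (by positivity) (hz0 i))]
    have h1 : z i < 2 ^ N := calc
      z i ≤ ‖z‖ := (le_abs_self _).trans (norm_le_pi_norm z i)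
      _ ≤ R := hR z hz
      _ < 2 ^ N₂ := hN₂
      _ ≤ 2 ^ N := pow_le_pow_right₀ one_le_two ((le_max_right _ _).trans hN)
    calc (2 : ℝ) ^ N * z i < 2 ^ N * 2 ^ N := by gcongr
      _ = ((4 ^ N : ℕ) : ℝ) := by push_cast; rw [← mul_pow]; norm_num
  · intro θ' hθ'0 hθ' w hw
    have hsmall : (1 / 2 : ℝ) ^ N < δ / 2 :=
      (pow_le_pow_of_le_one (by norm_num) (by norm_num) ((le_max_left _ _).trans hN)).trans_lt hN₁
    refine hthick (Metric.mem_thickening_iff.2 ⟨(θ₀, z), ⟨rfl, hz⟩, ?_⟩)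
    rw [mem_dyadicCube] at hw
    rw [Prod.dist_eq, max_lt_iff]
    constructor
    · have h1 : dist θ' θ < δ / 2 := (dist_pi_lt_iff (half_pos hδ)).2 fun i =>
        (abs_sub_le_of_dyadicIndex_eq hθ'0 hθ0 hθ' i).trans hsmall
      have h2 : dist θ θ₀ < δ / 2 := hθ
      exact (dist_triangle _ θ _).trans_lt (by linarith)
    · refine (dist_pi_lt_iff hδ).2 fun i => ?_
      exact (abs_sub_le_of_dyadicIndex_eq hw.1 hz0 hw.2 i).trans (by linarith)

theorem exists_forall_lt_volume_goodCubes (hO : IsOpen O) {K : Set (Fin m → ℝ)} (hK : IsCompact K)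
    (hK0 : ∀ θ ∈ K, ∀ i, 0 ≤ θ i) (hpos : ∀ θ ∈ K, ∀ z, (θ, z) ∈ O → ∀ i, 0 ≤ z i) {ε : ℝ≥0∞}
    (hε : ∀ θ ∈ K, ε < volume {z | (θ, z) ∈ O}) :
    ∃ N₀, ∀ N ≥ N₀, ∀ θ ∈ K,
      ε < volume (dyadicUnion N (goodCubes O N (dyadicIndex N θ))) := by
  have := hK.induction_on (p := fun s => ∃ N₀, ∀ N ≥ N₀, ∀ θ ∈ s, (∀ i, 0 ≤ θ i) →
      ε < volume (dyadicUnion N (goodCubes O N (dyadicIndex N θ))))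
    ⟨0, by simp⟩ (fun s t hst ⟨N, h⟩ => ⟨N, fun N' hN' θ hθ => h N' hN' θ (hst hθ)⟩)
    (fun s t ⟨N, h⟩ ⟨N', h'⟩ => ⟨max N N', fun N'' hN θ hθ => hθ.elim
      (h N'' ((le_max_left _ _).trans hN) θ) (h' N'' ((le_max_right _ _).trans hN) θ)⟩)
    (fun θ hθ => by
      obtain ⟨δ, hδ, h⟩ := exists_ball_lt_volume_goodCubes hO (hpos θ hθ) (hε θ hθ)
      exact ⟨_, mem_nhdsWithin_of_mem_nhds (Metric.ball_mem_nhds θ hδ), h⟩)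
  obtain ⟨N₀, h⟩ := this
  exact ⟨N₀, fun N hN θ hθ => h N hN θ hθ (hK0 θ hθ)⟩

/-- A natural number which is large when a point of the open unit cube is close to its boundary. -/
noncomputable def boundaryLevel (θ : Fin m → ℝ) : ℕ := ⌊∑ i, 1 / (θ i * (1 - θ i))⌋₊

theorem exists_isCompact_boundaryLevel (m M : ℕ) : ∃ K : Set (Fin m → ℝ), IsCompact K ∧
    (∀ θ ∈ K, ∀ i, 0 < θ i ∧ θ i < 1) ∧
    ∀ θ : Fin m → ℝ, (∀ i, 0 < θ i ∧ θ i < 1) → boundaryLevel θ = M → θ ∈ K := by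
  have hM : (0 : ℝ) < 1 / (M + 1) := by positivity
  -- Level `M` forces `θ i * (1 - θ i) > 1 / (M + 1)`, and each factor is at least the product.
  refine ⟨Set.univ.pi fun _ => Set.Icc (1 / (M + 1)) (1 - 1 / (M + 1)),
    isCompact_univ_pi fun _ => isCompact_Icc, fun θ hθ i => ?_, fun θ hθ h i _ => ?_⟩
  · have := hθ i trivial
    exact ⟨hM.trans_le this.1, by linarith [this.2]⟩
  · have hpos : ∀ i, 0 < θ i * (1 - θ i) := fun i => mul_pos (hθ i).1 (sub_pos.2 (hθ i).2)
    have h1 : ∑ i, 1 / (θ i * (1 - θ i)) < M + 1 := by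
      rw [← h]
      exact Nat.lt_floor_add_one _
    have h2 : 1 / (θ i * (1 - θ i)) < M + 1 :=
      (Finset.single_le_sum (f := fun i => 1 / (θ i * (1 - θ i)))
        (fun i _ => (one_div_pos.2 (hpos i)).le) (Finset.mem_univ i)).trans_lt h1
    have h3 := (one_div_lt_one_div_of_lt (one_div_pos.2 (hpos i)) h2).le
    rw [one_div_one_div] at h3
    constructor <;> nlinarith [(hθ i).1, (hθ i).2]

/-- The resolution must depend on θ only through a natural number, so that it can be looked up in a
table. The parameters of level `M` lie in a compact set, on which every sufficiently fine resolution
serves stage `j`; strictly increasing choices are then possible. -/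
theorem exists_levels (hO : IsOpen O)
    (hpos : ∀ θ : Fin m → ℝ, (∀ i, 0 < θ i ∧ θ i < 1) → ∀ z, (θ, z) ∈ O → ∀ i, 0 ≤ z i)
    (hvol : ∀ θ : Fin m → ℝ, (∀ i, 0 < θ i ∧ θ i < 1) → volume {z | (θ, z) ∈ O} = 1) :
    ∃ L : ℕ → ℕ → ℕ, ∀ M, StrictMono (L M) ∧ ∀ j, j + 1 ≤ L M j ∧
      ∀ θ : Fin m → ℝ, (∀ i, 0 < θ i ∧ θ i < 1) → boundaryLevel θ = M →
        1 ≤ volume (dyadicUnion (L M j) (goodCubes O (L M j) (dyadicIndex (L M j) θ))) +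
          ((2 : ℝ≥0∞) ^ (j + 1))⁻¹ := by
  have key : ∀ M, ∃ φ : ℕ → ℕ, StrictMono φ ∧ ∀ j, j + 1 ≤ φ j ∧
      ∀ θ : Fin m → ℝ, (∀ i, 0 < θ i ∧ θ i < 1) → boundaryLevel θ = M →
        1 ≤ volume (dyadicUnion (φ j) (goodCubes O (φ j) (dyadicIndex (φ j) θ))) +
          ((2 : ℝ≥0∞) ^ (j + 1))⁻¹ := by
    intro M
    obtain ⟨K, hK, hK1, hK2⟩ := exists_isCompact_boundaryLevel m M
    refine Filter.extraction_forall_of_eventually' (P := fun j N => j + 1 ≤ N ∧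
      ∀ θ : Fin m → ℝ, (∀ i, 0 < θ i ∧ θ i < 1) → boundaryLevel θ = M →
        1 ≤ volume (dyadicUnion N (goodCubes O N (dyadicIndex N θ))) +
          ((2 : ℝ≥0∞) ^ (j + 1))⁻¹) fun j => ?_
    obtain ⟨N₀, hN₀⟩ := exists_forall_lt_volume_goodCubes hO hK
      (fun θ hθ i => (hK1 θ hθ i).1.le) (fun θ hθ => hpos θ (hK1 θ hθ))
      (ε := 1 - ((2 : ℝ≥0∞) ^ (j + 1))⁻¹) fun θ hθ => by
        rw [hvol θ (hK1 θ hθ)]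
        exact ENNReal.sub_lt_self (by simp) (by simp) (by simp)
    refine ⟨max N₀ (j + 1), fun N hN => ⟨(le_max_right _ _).trans hN, fun θ hθ hM => ?_⟩⟩
    exact tsub_le_iff_right.1 (hN₀ N ((le_max_left _ _).trans hN) θ (hK2 θ hθ hM)).le
  choose L hL using key
  exact ⟨L, hL⟩

end

/-! ### Exhausting a set of volume 1 by disjoint dyadic cubes in stages -/

section

/-- A subset of `s` with `n` elements, if there is one. -/
noncomputable def pickSubset {α : Type*} (s : Finset α) (n : ℕ) : Finset α :=
  if h : n ≤ s.card then (Finset.exists_subset_card_eq h).choose else ∅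

theorem pickSubset_subset {α : Type*} (s : Finset α) (n : ℕ) : pickSubset s n ⊆ s := by
  rw [pickSubset]
  split_ifs with h
  · exact (Finset.exists_subset_card_eq h).choose_spec.1
  · exact Finset.empty_subset s

theorem card_pickSubset {α : Type*} {s : Finset α} {n : ℕ} (h : n ≤ s.card) :
    (pickSubset s n).card = n := by
  rw [pickSubset, dif_pos h]
  exact (Finset.exists_subset_card_eq h).choose_spec.2

variable {d : ℕ}

open Classical in
/-- The cubes of side `2 ^ (-N)` of total volume `2 ^ (-(j + 1))` which are picked among those with
indices in `A` that do not meet `W`. -/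
noncomputable def pickCubes (N j : ℕ) (A : Finset (Fin d → ℕ)) (W : Set (Fin d → ℝ)) :
    Finset (Fin d → ℕ) :=
  pickSubset (A.filter fun c => Disjoint (dyadicCube N c) W) (2 ^ (N * d - (j + 1)))

/-- The region covered by the cubes picked at the first `j` stages. -/
noncomputable def usedRegion (L : ℕ → ℕ) (A : ℕ → Finset (Fin d → ℕ)) : ℕ → Set (Fin d → ℝ)
  | 0 => ∅
  | j + 1 => usedRegion L A j ∪ dyadicUnion (L j) (pickCubes (L j) j (A j) (usedRegion L A j))

/-- The cubes picked at stage `j`. -/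
noncomputable def stageCubes (L : ℕ → ℕ) (A : ℕ → Finset (Fin d → ℕ)) (j : ℕ) :
    Finset (Fin d → ℕ) :=
  pickCubes (L j) j (A j) (usedRegion L A j)

variable {L : ℕ → ℕ} {A A' : ℕ → Finset (Fin d → ℕ)}

theorem usedRegion_succ (L : ℕ → ℕ) (A : ℕ → Finset (Fin d → ℕ)) (j : ℕ) :
    usedRegion L A (j + 1) = usedRegion L A j ∪ dyadicUnion (L j) (stageCubes L A j) := rfl

theorem usedRegion_congr {j : ℕ} (h : ∀ i < j, A i = A' i) :
    usedRegion L A j = usedRegion L A' j := by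
  induction j with
  | zero => rfl
  | succ j ih => rw [usedRegion, usedRegion, ih fun i hi => h i (by omega), h j (by omega)]

/-- The choice at a stage never looks ahead. This is what later makes the selected cube a function
of finitely many integers. -/
theorem stageCubes_congr {j : ℕ} (h : ∀ i ≤ j, A i = A' i) :
    stageCubes L A j = stageCubes L A' j := by
  rw [stageCubes, stageCubes, usedRegion_congr fun i hi => h i hi.le, h j le_rfl]

theorem stageCubes_subset (j : ℕ) : stageCubes L A j ⊆ A j := by
  classical
  exact (pickSubset_subset _ _).trans (Finset.filter_subset _ _)

theorem disjoint_usedRegion (j : ℕ) :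
    Disjoint (usedRegion L A j) (dyadicUnion (L j) (stageCubes L A j)) := by
  classical
  rw [dyadicUnion, Set.disjoint_iUnion₂_right]
  intro c hc
  exact (Finset.mem_filter.1 (pickSubset_subset _ _ hc)).2.symm

theorem dyadicUnion_subset_usedRegion {i j : ℕ} (h : i < j) :
    dyadicUnion (L i) (stageCubes L A i) ⊆ usedRegion L A j := by
  induction j, h using Nat.le_induction with
  | base => exact Set.subset_union_right
  | succ j _ ih => exact ih.trans Set.subset_union_left

/-- The used region is a union of coarser dyadic cubes, and dyadic cubes are nested or disjoint. -/
theorem dyadicCube_subset_or_disjoint_usedRegion {N j : ℕ} (h : ∀ i < j, L i ≤ N)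
    (c : Fin d → ℕ) :
    dyadicCube N c ⊆ usedRegion L A j ∨ Disjoint (dyadicCube N c) (usedRegion L A j) := by
  induction j with
  | zero => exact .inr (Set.disjoint_empty _)
  | succ j ih =>
    rw [usedRegion_succ]
    rcases ih fun i hi => h i (by omega) with h1 | h1
    · exact .inl (h1.trans Set.subset_union_left)
    · by_cases h2 : ∃ c' ∈ stageCubes L A j, dyadicCube N c ⊆ dyadicCube (L j) c'
      · obtain ⟨c', hc', hs⟩ := h2
        refine .inl (subset_trans ?_ Set.subset_union_right)
        exact hs.trans (Set.subset_biUnion_of_mem (u := dyadicCube (L j)) hc')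
      · push Not at h2
        refine .inr (Set.disjoint_union_right.2 ⟨h1, Set.disjoint_iUnion₂_right.2 fun c' hc' => ?_⟩)
        exact (dyadicCube_subset_or_disjoint (h j (Nat.lt_succ_self j)) c c').resolve_left
          (h2 c' hc')

theorem inv_two_pow_eq_add (j : ℕ) :
    ((2 : ℝ≥0∞) ^ j)⁻¹ = ((2 : ℝ≥0∞) ^ (j + 1))⁻¹ + ((2 : ℝ≥0∞) ^ (j + 1))⁻¹ := by
  rw [← two_mul, pow_succ, ENNReal.mul_inv (by simp) (by simp), mul_comm, mul_assoc,
    ENNReal.inv_mul_cancel (by simp) (by simp), mul_one]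

theorem two_pow_mul_inv_two_pow {a b : ℕ} (h : a ≤ b) :
    (2 : ℝ≥0∞) ^ (b - a) * (2 ^ b)⁻¹ = (2 ^ a)⁻¹ := by
  obtain ⟨e, rfl⟩ := Nat.exists_eq_add_of_le h
  rw [Nat.add_sub_cancel_left, pow_add, ENNReal.mul_inv (by simp) (by simp), mul_comm, mul_assoc,
    ENNReal.inv_mul_cancel (by simp) (by simp), mul_one]

/-- The level `L` and the families `A` are rich enough for a choice of cubes of total volume
`2 ^ (-(j + 1))` at every stage `j`. -/
structure IsRich (L : ℕ → ℕ) (A : ℕ → Finset (Fin d → ℕ)) : Prop where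
  strictMono : StrictMono L
  le_mul : ∀ j, j + 1 ≤ L j * d
  volume : ∀ j, 1 ≤ volume (dyadicUnion (L j) (A j)) + ((2 : ℝ≥0∞) ^ (j + 1))⁻¹

/-- The used region leaves volume `2 ^ (-j)` free, and the cubes in `A j` miss at most half of that.
The unused ones therefore have volume at least `2 ^ (-(j + 1))`, which is a whole number of cubes
because `j + 1 ≤ L j * d`. -/
theorem IsRich.card_stageCubes_of (h : IsRich L A) {j : ℕ}
    (hj : MeasureTheory.volume (usedRegion L A j) + ((2 : ℝ≥0∞) ^ j)⁻¹ = 1) :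
    (stageCubes L A j).card = 2 ^ (L j * d - (j + 1)) := by
  classical
  refine card_pickSubset ?_
  set B := (A j).filter fun c => Disjoint (dyadicCube (L j) c) (usedRegion L A j) with hB
  have hsub : dyadicUnion (L j) (A j) ⊆ usedRegion L A j ∪ dyadicUnion (L j) B := by
    refine Set.iUnion₂_subset fun c hc => ?_
    rcases dyadicCube_subset_or_disjoint_usedRegion (L := L) (A := A) (N := L j) (j := j)
      (fun i hi => (h.strictMono hi).le) c with h1 | h1
    · exact h1.trans Set.subset_union_left
    · exact (Set.subset_biUnion_of_mem (u := dyadicCube (L j))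
        (Finset.mem_coe.2 (Finset.mem_filter.2 ⟨hc, h1⟩))).trans Set.subset_union_right
  have hfin : MeasureTheory.volume (usedRegion L A j) ≠ ∞ := fun htop => by simp [htop] at hj
  have h1 := (h.volume j).trans
    (add_le_add_left ((measure_mono hsub).trans (measure_union_le _ _)) _)
  rw [← hj, inv_two_pow_eq_add j, add_assoc, volume_dyadicUnion] at h1
  have h2 := (ENNReal.add_le_add_iff_left hfin).1 h1
  have h3 := (ENNReal.add_le_add_iff_right (by simp)).1 h2
  rw [← two_pow_mul_inv_two_pow (h.le_mul j)] at h3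
  have h4 := (ENNReal.mul_le_mul_iff_left (by simp) (by simp)).1 h3
  exact_mod_cast h4

theorem IsRich.volume_usedRegion (h : IsRich L A) (j : ℕ) :
    MeasureTheory.volume (usedRegion L A j) + ((2 : ℝ≥0∞) ^ j)⁻¹ = 1 := by
  induction j with
  | zero => simp [usedRegion]
  | succ j ih =>
    rw [usedRegion_succ, measure_union (disjoint_usedRegion j) (measurableSet_dyadicUnion _ _),
      volume_dyadicUnion, h.card_stageCubes_of ih]
    push_cast
    rw [two_pow_mul_inv_two_pow (h.le_mul j), add_assoc, ← inv_two_pow_eq_add, ih]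

theorem IsRich.card_stageCubes (h : IsRich L A) (j : ℕ) :
    (stageCubes L A j).card = 2 ^ (L j * d - (j + 1)) :=
  h.card_stageCubes_of (h.volume_usedRegion j)

/-- The stages are disjoint parts of `O` with volumes `1/2, 1/4, …`, so together they fill `O` up to
a null set. -/
theorem IsRich.volume_inter (h : IsRich L A) {O : Set (Fin d → ℝ)}
    (hO : MeasureTheory.volume O = 1) (hA : ∀ j, dyadicUnion (L j) (A j) ⊆ O)
    {B : Set (Fin d → ℝ)} (hB : MeasurableSet B) :
    ∑' j, ∑ c ∈ stageCubes L A j, MeasureTheory.volume (B ∩ dyadicCube (L j) c) =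
      MeasureTheory.volume (B ∩ O) := by
  set P : ℕ → Set (Fin d → ℝ) := fun j => dyadicUnion (L j) (stageCubes L A j) with hP
  have hPm : ∀ j, MeasurableSet (P j) := fun j => measurableSet_dyadicUnion _ _
  have hlt : ∀ i j, i < j → Disjoint (P i) (P j) := fun i j hij =>
    (disjoint_usedRegion j).mono_left (dyadicUnion_subset_usedRegion hij)
  have hPd : Pairwise (Function.onFun Disjoint P) := fun i j hij =>
    (lt_or_gt_of_ne hij).elim (hlt i j) fun hji => (hlt j i hji).symm
  have hPO : (⋃ j, P j) ⊆ O := Set.iUnion_subset fun j =>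
    subset_trans (Set.biUnion_subset_biUnion_left (stageCubes_subset j)) (hA j)
  have hvol : MeasureTheory.volume (⋃ j, P j) = 1 := by
    rw [measure_iUnion hPd hPm]
    have : ∀ j, MeasureTheory.volume (P j) = (2⁻¹ : ℝ≥0∞) ^ (j + 1) := fun j => by
      rw [hP, volume_dyadicUnion, h.card_stageCubes, ← ENNReal.inv_pow]
      push_cast
      exact two_pow_mul_inv_two_pow (h.le_mul j)
    simp only [this]
    rw [ENNReal.tsum_geometric_add_one, ENNReal.one_sub_inv_two, inv_inv,
      ENNReal.inv_mul_cancel (by simp) (by simp)]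
  have hae : (⋃ j, P j) =ᵐ[MeasureTheory.volume] O :=
    ae_eq_of_subset_of_measure_ge hPO (by rw [hvol, hO])
      (MeasurableSet.iUnion hPm).nullMeasurableSet (by simp [hO])
  rw [← measure_congr (Filter.EventuallyEq.rfl.inter hae), Set.inter_iUnion, measure_iUnion
    (fun i j hij => (hPd hij).mono Set.inter_subset_right Set.inter_subset_right)
    fun j => hB.inter (hPm j)]
  exact tsum_congr fun j => (volume_inter_dyadicUnion _ _ hB).symm

end

/-! ### Sampling a cube with one uniform and a point of it with the others -/

section

/-- A geometric random variable, as a function of a uniform one: the `j` with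
`2 ^ (-(j + 1)) < v ≤ 2 ^ (-j)`. -/
noncomputable def stage (v : ℝ) : ℕ := Nat.log 2 ⌊v⁻¹⌋₊

/-- The position of `v` inside `(2 ^ (-(j + 1)), 2 ^ (-j)]`, `j = stage v`, when that interval is
divided into intervals of length `2 ^ (-n j)`. -/
noncomputable def position (n : ℕ → ℕ) (v : ℝ) : ℕ :=
  ⌈2 ^ n (stage v) * v⌉₊ - 1 - 2 ^ (n (stage v) - (stage v + 1))

theorem stage_eq_iff {v : ℝ} (hv : v ∈ Set.Ioo (0 : ℝ) 1) (j : ℕ) :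
    stage v = j ↔ 1 < 2 ^ (j + 1) * v ∧ 2 ^ j * v ≤ 1 := by
  have hinv : 1 ≤ v⁻¹ := (one_le_inv₀ hv.1).2 hv.2.le
  have h0 : ⌊v⁻¹⌋₊ ≠ 0 := (Nat.floor_pos.2 hinv).ne'
  rw [stage, Nat.log_eq_iff (.inr ⟨one_lt_two, h0⟩), Nat.le_floor_iff (by positivity),
    Nat.floor_lt (by positivity)]
  push_cast
  rw [le_inv_comm₀ (by positivity) hv.1, inv_lt_comm₀ hv.1 (by positivity), and_comm,
    ← one_div, ← one_div, div_lt_iff₀ (by positivity), le_div_iff₀ (by positivity), mul_comm v,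
    mul_comm v]

theorem measurable_stage_position (n : ℕ → ℕ) : Measurable fun v => (stage v, position n v) := by
  have h1 : Measurable stage :=
    (Measurable.of_discrete (f := Nat.log 2)).comp (Nat.measurable_floor.comp measurable_inv)
  have h2 : Measurable fun v => ⌈2 ^ n (stage v) * v⌉₊ := Nat.measurable_ceil.comp
    (((Measurable.of_discrete (f := fun j => (2 : ℝ) ^ n j)).comp h1).mul measurable_id)
  exact (Measurable.of_discrete (f := fun p : ℕ × ℕ =>
    (p.1, p.2 - 1 - 2 ^ (n p.1 - (p.1 + 1))))).comp (h1.prodMk h2)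

theorem mul_two_pow_of_le {n j : ℕ} (hn : j + 1 ≤ n) (v : ℝ) :
    2 ^ n * v = (2 ^ (n - (j + 1)) : ℕ) * (2 ^ (j + 1) * v) := by
  push_cast
  rw [← mul_assoc, ← pow_add]
  congr 2
  omega

theorem lt_and_le_of_stage_eq {n j : ℕ} (hn : j + 1 ≤ n) {v : ℝ} (hv : v ∈ Set.Ioo (0 : ℝ) 1)
    (hj : stage v = j) :
    ((2 ^ (n - (j + 1)) : ℕ) : ℝ) < 2 ^ n * v ∧
      2 ^ n * v ≤ (2 * 2 ^ (n - (j + 1)) : ℕ) := by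
  obtain ⟨h1, h2⟩ := (stage_eq_iff hv j).1 hj
  have hK : (0 : ℝ) < (2 ^ (n - (j + 1)) : ℕ) := by positivity
  rw [mul_two_pow_of_le hn, Nat.cast_mul, Nat.cast_ofNat]
  constructor
  · nlinarith
  · rw [pow_succ]
    nlinarith

theorem volume_stage_position_of_lt (n : ℕ → ℕ) {j i : ℕ} (hn : j + 1 ≤ n j)
    (hi : i < 2 ^ (n j - (j + 1))) :
    (volume.restrict (Set.Ioo (0 : ℝ) 1)).map (fun v => (stage v, position n v)) {(j, i)} =
      ((2 : ℝ≥0∞) ^ n j)⁻¹ := by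
  rw [Measure.map_apply (measurable_stage_position n) (measurableSet_singleton _),
    Measure.restrict_apply (measurable_stage_position n (measurableSet_singleton _))]
  -- In units of `2 ^ (-n j)` the interval of stage `j` is `(K, 2 * K]`, and position `i` is the
  -- cell `(K + i, K + i + 1]`.
  set K := 2 ^ (n j - (j + 1)) with hK
  have h2 : (0 : ℝ) < 2 ^ n j := by positivity
  have hlen : ((K + i + 1 : ℕ) : ℝ) / 2 ^ n j - (K + i : ℕ) / 2 ^ n j = (2 ^ n j)⁻¹ := by
    push_cast
    ring
  have hval : ENNReal.ofReal ((2 ^ n j)⁻¹) = ((2 : ℝ≥0∞) ^ n j)⁻¹ := by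
    rw [ENNReal.ofReal_inv_of_pos h2, ENNReal.ofReal_pow two_pos.le, ENNReal.ofReal_ofNat]
  have hKpos : 0 < K := by positivity
  -- The event is squeezed between the open and the half-open cell, of equal length, so the endpoint
  -- `v = 1` needs no separate treatment.
  refine le_antisymm ?_ ?_
  · rw [← hval, ← hlen, ← Real.volume_Ioc]
    refine measure_mono fun v hv => ?_
    obtain ⟨hji, hv⟩ := hv
    obtain ⟨hj, hp⟩ := Prod.mk_inj.1 (Set.mem_singleton_iff.1 hji)
    have h := (lt_and_le_of_stage_eq hn hv hj).1
    rw [position, hj, ← hK] at hp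
    have hc : K < ⌈2 ^ n j * v⌉₊ := Nat.lt_ceil.2 h
    have hc' : ⌈2 ^ n j * v⌉₊ = K + i + 1 := by omega
    have := (Nat.ceil_eq_iff (Nat.succ_ne_zero _)).1 hc'
    rw [Set.mem_Ioc, div_lt_iff₀ h2, le_div_iff₀ h2, mul_comm v]
    exact this
  · rw [← hval, ← hlen, ← Real.volume_Ioo]
    refine measure_mono fun v hv => ?_
    rw [Set.mem_Ioo, div_lt_iff₀ h2, lt_div_iff₀ h2, mul_comm v] at hv
    have hup : ((K + i + 1 : ℕ) : ℝ) ≤ K * 2 := by exact_mod_cast (by omega : K + i + 1 ≤ K * 2)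
    have hlo : (K : ℝ) ≤ (K + i : ℕ) := by exact_mod_cast Nat.le_add_right K i
    have hKr : (0 : ℝ) < K := by exact_mod_cast hKpos
    have hmul := mul_two_pow_of_le hn v
    rw [← hK] at hmul
    have hpow : (1 : ℝ) ≤ 2 ^ j := one_le_pow₀ one_le_two
    have h1 : 1 < 2 ^ (j + 1) * v := by
      by_contra hneg
      nlinarith [hv.1, not_lt.1 hneg]
    have h3 : 2 ^ j * v < 1 := by
      rw [pow_succ] at hmul
      by_contra hneg
      nlinarith [hv.2, not_lt.1 hneg]
    have hv0 : 0 < v := pos_of_mul_pos_right (zero_lt_one.trans h1) (by positivity)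
    have hv1 : v ∈ Set.Ioo (0 : ℝ) 1 := ⟨hv0, by nlinarith⟩
    have hj : stage v = j := (stage_eq_iff hv1 j).2 ⟨h1, h3.le⟩
    refine ⟨Prod.ext hj ?_, hv1⟩
    have hc : ⌈2 ^ n j * v⌉₊ = K + i + 1 :=
      (Nat.ceil_eq_iff (Nat.succ_ne_zero _)).2 ⟨hv.1, hv.2.le⟩
    simp only [position, hj, hc, ← hK]
    omega

theorem volume_stage_position_of_le (n : ℕ → ℕ) {j i : ℕ} (hn : j + 1 ≤ n j)
    (hi : 2 ^ (n j - (j + 1)) ≤ i) :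
    (volume.restrict (Set.Ioo (0 : ℝ) 1)).map (fun v => (stage v, position n v)) {(j, i)} = 0 := by
  rw [Measure.map_apply (measurable_stage_position n) (measurableSet_singleton _),
    Measure.restrict_apply (measurable_stage_position n (measurableSet_singleton _))]
  refine measure_mono_null (fun v hv => ?_) measure_empty
  obtain ⟨hji, hv⟩ := hv
  obtain ⟨hj, hp⟩ := Prod.mk_inj.1 (Set.mem_singleton_iff.1 hji)
  have h := Nat.ceil_le.2 (lt_and_le_of_stage_eq hn hv hj).2
  rw [position, hj] at hp
  have : 0 < 2 ^ (n j - (j + 1)) := by positivity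
  omega

theorem lintegral_stage_position (n : ℕ → ℕ) (hn : ∀ j, j + 1 ≤ n j) (F : ℕ × ℕ → ℝ≥0∞) :
    ∫⁻ v in Set.Ioo (0 : ℝ) 1, F (stage v, position n v) =
      ∑' j, ∑ i ∈ Finset.range (2 ^ (n j - (j + 1))), F (j, i) * ((2 : ℝ≥0∞) ^ n j)⁻¹ := by
  rw [← lintegral_map (f := F) .of_discrete (measurable_stage_position n), lintegral_countable',
    ENNReal.tsum_prod']
  refine tsum_congr fun j => ?_
  rw [tsum_eq_sum (s := Finset.range (2 ^ (n j - (j + 1))))]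
  · exact Finset.sum_congr rfl fun i hi => by
      rw [volume_stage_position_of_lt n (hn j) (Finset.mem_range.1 hi)]
  · intro i hi
    rw [volume_stage_position_of_le n (hn j) (by simpa using hi), mul_zero]

variable {d : ℕ}

/-- The `i`-th element of a finite set of indices. -/
noncomputable def nthCube (s : Finset (Fin d → ℕ)) (i : ℕ) : Fin d → ℕ :=
  if h : i < s.card then s.equivFin.symm ⟨i, h⟩ else 0

theorem sum_nthCube (s : Finset (Fin d → ℕ)) (F : (Fin d → ℕ) → ℝ≥0∞) :
    ∑ i ∈ Finset.range s.card, F (nthCube s i) = ∑ c ∈ s, F c := by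
  rw [Finset.sum_range, ← Finset.sum_coe_sort s, ← Equiv.sum_comp s.equivFin.symm]
  exact Finset.sum_congr rfl fun i _ => by simp [nthCube]

theorem uniformCube_eq_restrict (d : ℕ) :
    uniformCube d = volume.restrict (Set.univ.pi fun _ => Set.Ioo (0 : ℝ) 1) := by
  rw [uniformCube, volume_pi, Measure.restrict_pi_pi]

instance (d : ℕ) : IsProbabilityMeasure (uniformCube d) := by
  constructor
  rw [uniformCube, Measure.pi_univ]
  simp

theorem ae_uniformCube (d : ℕ) : ∀ᵐ u ∂uniformCube d, ∀ i, u i ∈ Set.Ioo (0 : ℝ) 1 := by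
  rw [uniformCube_eq_restrict]
  filter_upwards [ae_restrict_mem (MeasurableSet.univ_pi fun _ => measurableSet_Ioo)] with u hu i
  exact hu i trivial

/-- A uniform point of a dyadic cube, as a function of a uniform point of the unit cube. -/
theorem uniformCube_affine_preimage (N : ℕ) (c : Fin d → ℕ) {B : Set (Fin d → ℝ)}
    (hB : MeasurableSet B) :
    uniformCube d {u | (fun a => ((2 : ℝ) ^ N)⁻¹ * (c a + u a)) ∈ B} =
      2 ^ (N * d) * volume (B ∩ dyadicCube N c) := by
  have h2 : (0 : ℝ) < 2 ^ N := by positivity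
  set Q : Set (Fin d → ℝ) :=
    Set.univ.pi fun i => Set.Ioo ((c i : ℝ) / 2 ^ N) ((c i + 1) / 2 ^ N) with hQ
  -- The open unit cube maps onto the open cube `Q`, which differs from the half-open one by a null
  -- set.
  have hae : Q =ᵐ[volume] dyadicCube N c :=
    Measure.univ_pi_Ioo_ae_eq_Icc.trans Measure.univ_pi_Ico_ae_eq_Icc.symm
  have hm : MeasurableSet {u : Fin d → ℝ | (fun a => ((2 : ℝ) ^ N)⁻¹ * (c a + u a)) ∈ B} :=
    hB.preimage (by fun_prop)
  have hset : {u : Fin d → ℝ | (fun a => ((2 : ℝ) ^ N)⁻¹ * (c a + u a)) ∈ B} ∩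
      (Set.univ.pi fun _ => Set.Ioo (0 : ℝ) 1) =
      (fun u => (fun a => (c a : ℝ)) + u) ⁻¹' ((fun z => ((2 : ℝ) ^ N)⁻¹ • z) ⁻¹' (B ∩ Q)) := by
    ext u
    simp only [Set.mem_inter_iff, Set.mem_ofPred_eq, Set.mem_preimage, hQ, Set.mem_univ_pi,
      Set.mem_Ioo]
    refine and_congr Iff.rfl (forall_congr' fun i => ?_)
    simp only [Pi.smul_apply, Pi.add_apply, smul_eq_mul]
    rw [inv_mul_eq_div, div_lt_div_iff_of_pos_right h2, div_lt_div_iff_of_pos_right h2]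
    constructor <;> rintro ⟨h, h'⟩ <;> constructor <;> linarith
  rw [uniformCube_eq_restrict, Measure.restrict_apply hm, hset, measure_preimage_add,
    Measure.addHaar_preimage_smul _ (inv_pos.2 h2).ne',
    measure_congr (Filter.EventuallyEq.rfl.inter hae)]
  congr 1
  rw [Module.finrank_fin_fun, inv_pow, inv_inv, abs_of_pos (by positivity), ← pow_mul,
    ENNReal.ofReal_pow two_pos.le, ENNReal.ofReal_ofNat]

/-- The sampler: the first uniform selects a cube, the others a point of this cube. -/
noncomputable def sampler (L : ℕ → ℕ) (A : ℕ → Finset (Fin d → ℕ)) (u : Fin (d + 1) → ℝ) :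
    Fin d → ℝ :=
  fun a => ((2 : ℝ) ^ L (stage (u 0)))⁻¹ *
    (nthCube (stageCubes L A (stage (u 0))) (position (fun j => L j * d) (u 0)) a + u a.succ)

/-- Each picked cube of stage `j` is selected with probability `2 ^ (-(L j * d))`, exactly its
volume. A uniform point of it then contributes Lebesgue measure on that cube, and the cubes add up
to `O`. -/
theorem hasLaw_sampler {L : ℕ → ℕ} {A : ℕ → Finset (Fin d → ℕ)} (h : IsRich L A)
    {O : Set (Fin d → ℝ)} (hO : volume O = 1) (hA : ∀ j, dyadicUnion (L j) (A j) ⊆ O) :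
    HasLaw (sampler L A) (volume.restrict O) (uniformCube (d + 1)) := by
  set n : ℕ → ℕ := fun j => L j * d with hn
  let G : (ℕ × ℕ) × (Fin d → ℝ) → Fin d → ℝ := fun q a =>
    ((2 : ℝ) ^ L q.1.1)⁻¹ * (nthCube (stageCubes L A q.1.1) q.1.2 a + q.2 a)
  have hG : Measurable G := measurable_from_prod_countable_right fun p => by
    refine measurable_pi_lambda _ fun a => ?_
    simp only [G]
    fun_prop
  let H : ℝ × (Fin d → ℝ) → Fin d → ℝ := fun q => G ((stage q.1, position n q.1), q.2)
  have hH : Measurable H :=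
    hG.comp (((measurable_stage_position n).comp measurable_fst).prodMk measurable_snd)
  have hmp : MeasurePreserving (MeasurableEquiv.piFinSuccAbove (fun _ => ℝ) (0 : Fin (d + 1)))
      (uniformCube (d + 1)) ((volume.restrict (Set.Ioo (0 : ℝ) 1)).prod (uniformCube d)) :=
    measurePreserving_piFinSuccAbove (fun _ => volume.restrict (Set.Ioo (0 : ℝ) 1)) 0
  have hs : sampler L A = H ∘ MeasurableEquiv.piFinSuccAbove (fun _ => ℝ) (0 : Fin (d + 1)) := by
    funext u
    simp only [Function.comp_apply, MeasurableEquiv.piFinSuccAbove_apply, H, G,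
      Fin.insertNthEquiv_symm_apply]
    rfl
  refine ⟨hs ▸ (hH.comp hmp.measurable).aemeasurable, ?_⟩
  ext B hB
  rw [hs, ← Measure.map_map hH hmp.measurable, hmp.map_eq, Measure.map_apply hH hB,
    Measure.prod_apply (hH hB), Measure.restrict_apply hB]
  have hfib : ∀ v : ℝ, uniformCube d (Prod.mk v ⁻¹' (H ⁻¹' B)) =
      (fun p : ℕ × ℕ => 2 ^ n p.1 *
        volume (B ∩ dyadicCube (L p.1) (nthCube (stageCubes L A p.1) p.2)))
          (stage v, position n v) := fun v => by
    have hp : Prod.mk v ⁻¹' (H ⁻¹' B) = {u | (fun a => ((2 : ℝ) ^ L (stage v))⁻¹ *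
        (nthCube (stageCubes L A (stage v)) (position n v) a + u a)) ∈ B} := by
      ext u
      simp only [Set.mem_preimage, Set.mem_ofPred_eq, H, G]
    rw [hp]
    exact uniformCube_affine_preimage _ _ hB
  simp only [hfib]
  rw [lintegral_stage_position n h.le_mul (fun p : ℕ × ℕ => 2 ^ n p.1 *
        volume (B ∩ dyadicCube (L p.1) (nthCube (stageCubes L A p.1) p.2))),
    ← h.volume_inter hO hA hB]
  refine tsum_congr fun j => ?_
  rw [← h.card_stageCubes, ← sum_nthCube]
  refine Finset.sum_congr rfl fun i _ => ?_
  rw [mul_comm, ← mul_assoc, ENNReal.inv_mul_cancel (by simp) (by simp), one_mul]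

end

/-! ### The sampler as an expression -/

section

/-- The table may be an arbitrary function, so dependence on the inputs through an expressible code
alone already suffices. -/
theorem NatExpressible.of_factorsThrough {k m : ℕ} {S : Set ((Fin k → ℝ) × (Fin m → ℝ))}
    {x y : (Fin k → ℝ) × (Fin m → ℝ) → ℕ} (hx : NatExpressible S x)
    (h : ∀ s ∈ S, ∀ s' ∈ S, x s = x s' → y s = y s') : NatExpressible S y := by
  classical
  refine (hx.table fun q =>
    if hq : ∃ s ∈ S, x s = q then y hq.choose else 0).congr fun s hs => ?_
  have hq : ∃ s' ∈ S, x s' = x s := ⟨s, hs, rfl⟩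
  beta_reduce
  rw [dif_pos hq, h _ hq.choose_spec.1 s hs hq.choose_spec.2]

/-- The uniform inputs and the parameters all lie in `(0, 1)`. -/
def unitInputs (k m : ℕ) : Set ((Fin k → ℝ) × (Fin m → ℝ)) :=
  {s | (∀ i, s.1 i ∈ Set.Ioo (0 : ℝ) 1) ∧ ∀ i, 0 < s.2 i ∧ s.2 i < 1}

theorem natExpressible_boundaryLevel (k m : ℕ) :
    NatExpressible (unitInputs k m) fun s => boundaryLevel s.2 := by
  have h : ∀ s ∈ unitInputs k m, ∀ i, 0 < s.2 i * (1 - s.2 i) := fun s hs i =>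
    mul_pos (hs.2 i).1 (sub_pos.2 (hs.2 i).2)
  refine Expressible.natFloor (Expressible.congr (.sum Finset.univ
    (fun i s => if 0 < s.2 i * (1 - s.2 i) then 1 / (s.2 i * (1 - s.2 i)) else 0) fun i => ?_)
      fun s hs => ?_) fun s hs => Finset.sum_nonneg fun i _ => (one_div_pos.2 (h s hs i)).le
  · exact (Expressible.div (.const 1) (.mul (.param i) (.sub (.const 1) (.param i)))
      fun s hs => (h s hs i).ne').congr fun s hs => by rw [if_pos (h s hs i)]
  · exact Finset.sum_congr rfl fun i _ => if_pos (h s hs i)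

variable {m d : ℕ}

/-- Given the selected cube, the sampler is affine in the remaining uniforms. Its scale and corner
are table values, since they depend on the first uniform and on θ only through finitely many
integers. -/
theorem exists_expressible_hasLaw_restrict (hd : 0 < d) {O : Set ((Fin m → ℝ) × (Fin d → ℝ))}
    (hO : IsOpen O)
    (hpos : ∀ θ : Fin m → ℝ, (∀ i, 0 < θ i ∧ θ i < 1) → ∀ z, (θ, z) ∈ O → ∀ i, 0 ≤ z i)
    (hvol : ∀ θ : Fin m → ℝ, (∀ i, 0 < θ i ∧ θ i < 1) → volume {z | (θ, z) ∈ O} = 1) :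
    ∃ Z : (Fin (d + 1) → ℝ) × (Fin m → ℝ) → Fin d → ℝ,
      (∀ a, Expressible (unitInputs (d + 1) m) fun s => Z s a) ∧
      ∀ θ : Fin m → ℝ, (∀ i, 0 < θ i ∧ θ i < 1) →
        HasLaw (fun u => Z (u, θ)) (volume.restrict {z | (θ, z) ∈ O}) (uniformCube (d + 1)) := by
  obtain ⟨L, hL⟩ := exists_levels hO hpos hvol
  let A : (Fin m → ℝ) → ℕ → Finset (Fin d → ℕ) := fun θ j =>
    goodCubes O (L (boundaryLevel θ) j) (dyadicIndex (L (boundaryLevel θ) j) θ)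
  refine ⟨fun s => sampler (L (boundaryLevel s.2)) (A s.2) s.1, fun a => ?_, fun θ hθ => ?_⟩
  · set S := unitInputs (d + 1) m
    have hM : NatExpressible S fun s => boundaryLevel s.2 := natExpressible_boundaryLevel _ _
    have hj : NatExpressible S fun s => stage (s.1 0) := by
      have hinv : Expressible S fun s => (s.1 0)⁻¹ :=
        (Expressible.div (.const 1) (.unif 0) fun s hs => (hs.1 0).1.ne').congr fun s _ => by simp
      exact (hinv.natFloor fun s hs => (inv_pos.2 (hs.1 0).1).le).table (Nat.log 2)
    have hLj : NatExpressible S fun s => L (boundaryLevel s.2) (stage (s.1 0)) := hM.table₂ L hj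
    have hn : NatExpressible S fun s => L (boundaryLevel s.2) (stage (s.1 0)) * d :=
      hLj.mul (.const d)
    have hi : NatExpressible S fun s =>
        position (fun j => L (boundaryLevel s.2) j * d) (s.1 0) := by
      have hc : NatExpressible S fun s =>
          ⌈(2 : ℝ) ^ (L (boundaryLevel s.2) (stage (s.1 0)) * d) * s.1 0⌉₊ :=
        (Expressible.mul (.two_pow hn) (.unif 0)).natCeil fun s hs =>
          mul_nonneg (by positivity) (hs.1 0).1.le
      exact hc.table₂ (fun c e => c - 1 - 2 ^ e) (hn.table₂ (fun n j => n - (j + 1)) hj)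
    have hp : NatExpressible S fun s =>
        Encodable.encode (dyadicIndex (L (boundaryLevel s.2) (stage (s.1 0))) s.2) :=
      NatExpressible.table_pi _ fun i => (Expressible.mul (.two_pow hLj) (.param i)).natFloor
        fun s hs => mul_nonneg (by positivity) (hs.2 i).1.le
    -- One code for the level of θ, the stage, the position, and the dyadic cell of θ at the
    -- resolution of that stage.
    have hx := ((hM.table₂ Nat.pair hj).table₂ Nat.pair (hi.table₂ Nat.pair hp))
    have hcorner : NatExpressible S fun s =>
        nthCube (stageCubes (L (boundaryLevel s.2)) (A s.2) (stage (s.1 0)))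
          (position (fun j => L (boundaryLevel s.2) j * d) (s.1 0)) a := by
      refine hx.of_factorsThrough fun s _ s' _ hss => ?_
      simp only [Nat.pair_eq_pair, Encodable.encode_inj] at hss
      obtain ⟨⟨h1, h2⟩, h3, h4⟩ := hss
      rw [h3, h2, h1]
      rw [h2, h1] at h4
      -- The cubes of a stage involve the cells of θ at all earlier resolutions as well, but these
      -- are coarser and so determined by the current one.
      have e : stageCubes (L (boundaryLevel s'.2)) (A s.2) (stage (s'.1 0)) =
          stageCubes (L (boundaryLevel s'.2)) (A s'.2) (stage (s'.1 0)) :=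
        stageCubes_congr fun i hi => by
          simp only [A]
          rw [h1, dyadicIndex_eq_of_le ((hL _).1.monotone hi) h4]
      rw [e]
    exact Expressible.mul (.inv_two_pow hLj) (.add hcorner (.unif a.succ))
  · refine hasLaw_sampler ⟨(hL _).1, fun j => ?_, fun j => ((hL _).2 j).2 θ hθ rfl⟩ (hvol θ hθ)
      fun j z hz => dyadicUnion_goodCubes_subset (fun i => (hθ i).1.le) hz
    exact (((hL _).2 j).1).trans (Nat.le_mul_of_pos_right _ hd)

end

/-! ### Normalisation of the Dirichlet density -/

section

theorem lintegral_beta_scaled {p q s : ℝ} (hp : 0 < p) (hq : 0 < q) (hs : 0 < s) :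
    ∫⁻ y, (Set.Ioo 0 s).indicator
      (fun y => ENNReal.ofReal (y ^ (p - 1) * (s - y) ^ (q - 1))) y =
        ENNReal.ofReal (s ^ (p + q - 1) * beta p q) := by
  have hβ := beta_pos hp hq
  have h1 : ∀ t : ℝ, (Set.Ioo 0 s).indicator
      (fun y => ENNReal.ofReal (y ^ (p - 1) * (s - y) ^ (q - 1))) (s * t) =
        ENNReal.ofReal (s ^ (p - 1) * s ^ (q - 1) * beta p q) * betaPDF p q t := by
    intro t
    by_cases ht : 0 < t ∧ t < 1
    · have hm : s * t ∈ Set.Ioo 0 s := ⟨mul_pos hs ht.1, by nlinarith [ht.2]⟩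
      rw [Set.indicator_of_mem hm, betaPDF_of_pos_lt_one ht.1 ht.2,
        ← ENNReal.ofReal_mul (by positivity)]
      congr 1
      have e : s - s * t = s * (1 - t) := by ring
      rw [e, Real.mul_rpow hs.le ht.1.le, Real.mul_rpow hs.le (sub_pos.2 ht.2).le]
      field_simp
    · have hm : s * t ∉ Set.Ioo 0 s := fun h => ht
        ⟨pos_of_mul_pos_right h.1 hs.le, lt_of_mul_lt_mul_left (by simpa using h.2) hs.le⟩
      rw [Set.indicator_of_notMem hm, betaPDF_eq, if_neg ht]
      simp
  have hmeas : Measurable ((Set.Ioo 0 s).indicator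
      (fun y : ℝ => ENNReal.ofReal (y ^ (p - 1) * (s - y) ^ (q - 1)))) :=
    Measurable.indicator (by fun_prop) measurableSet_Ioo
  -- The substitution `y = s * t` reduces to the beta density on `(0, 1)`.
  conv_lhs => rw [← Real.smul_map_volume_mul_left hs.ne']
  rw [lintegral_smul_measure, lintegral_map hmeas (by fun_prop)]
  simp only [h1]
  rw [lintegral_const_mul' _ _ ENNReal.ofReal_ne_top, lintegral_betaPDF_eq_one hp hq, mul_one,
    smul_eq_mul, abs_of_pos hs, ← ENNReal.ofReal_mul hs.le]
  congr 1
  rw [← mul_assoc, ← mul_assoc, ← Real.rpow_one_add' hs.le (by linarith), ← Real.rpow_add hs]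
  congr 2
  ring

/-- The Dirichlet integral over the simplex of size `s`. -/
theorem lintegral_dirichlet {n : ℕ} (a : Fin n → ℝ) (ha : ∀ i, 0 < a i) {b s : ℝ} (hb : 0 < b)
    (hs : 0 < s) :
    ∫⁻ x, {x : Fin n → ℝ | (∀ i, 0 < x i) ∧ ∑ i, x i < s}.indicator
      (fun x => ENNReal.ofReal ((∏ i, x i ^ (a i - 1)) * (s - ∑ i, x i) ^ (b - 1))) x =
        ENNReal.ofReal (s ^ (∑ i, a i + b - 1) *
          ((∏ i, Real.Gamma (a i)) * Real.Gamma b / Real.Gamma (∑ i, a i + b))) := by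
  induction n generalizing s with
  | zero =>
    have h := (Real.Gamma_pos_of_pos hb).ne'
    simp [lintegral_unique, hs, h, volume_pi]
  | succ n ih =>
    set f : (Fin (n + 1) → ℝ) → ℝ≥0∞ := {x | (∀ i, 0 < x i) ∧ ∑ i, x i < s}.indicator
      (fun x => ENNReal.ofReal ((∏ i, x i ^ (a i - 1)) * (s - ∑ i, x i) ^ (b - 1))) with hf
    have hfm : Measurable f := by
      refine Measurable.indicator (by fun_prop) ?_
      have h1 : MeasurableSet {x : Fin (n + 1) → ℝ | ∀ i, 0 < x i} := by
        rw [Set.ofPred_forall]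
        exact .iInter fun i => measurableSet_lt measurable_const (measurable_pi_apply i)
      exact h1.inter (measurableSet_lt (f := fun x : Fin (n + 1) → ℝ => ∑ i, x i) (by fun_prop)
        measurable_const)
    have hmp := (volume_preserving_piFinSuccAbove (fun _ : Fin (n + 1) => ℝ) 0).symm
    rw [← hmp.lintegral_comp hfm, Measure.volume_eq_prod, lintegral_prod
      (fun q => f ((MeasurableEquiv.piFinSuccAbove (fun _ : Fin (n + 1) => ℝ) 0).symm q))
      (hfm.comp hmp.measurable).aemeasurable]
    set p : ℝ := ∑ i : Fin n, a i.succ with hpdef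
    have hp0 : 0 ≤ p := Finset.sum_nonneg fun i _ => (ha _).le
    set C : ℝ := (∏ i : Fin n, Real.Gamma (a i.succ)) * Real.Gamma b / Real.Gamma (p + b) with hC
    have hC0 : 0 ≤ C := div_nonneg (mul_nonneg (Finset.prod_nonneg fun i _ =>
      (Real.Gamma_pos_of_pos (ha _)).le) (Real.Gamma_pos_of_pos hb).le)
      (Real.Gamma_pos_of_pos (by linarith)).le
    -- With the first coordinate fixed at `y`, the others range over the simplex of size `s - y`.
    -- The induction hypothesis yields the power `(s - y) ^ (p + b - 1)`, leaving a one-dimensional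
    -- beta integral in `y`.
    have hin : ∀ y : ℝ, ∫⁻ x : Fin n → ℝ,
        f ((MeasurableEquiv.piFinSuccAbove (fun _ : Fin (n + 1) => ℝ) 0).symm (y, x)) =
        ENNReal.ofReal C * (Set.Ioo 0 s).indicator
          (fun y => ENNReal.ofReal (y ^ (a 0 - 1) * (s - y) ^ (p + b - 1))) y := by
      intro y
      have hcons : ∀ x : Fin n → ℝ,
          (MeasurableEquiv.piFinSuccAbove (fun _ : Fin (n + 1) => ℝ) 0).symm (y, x) =
            Fin.cons y x := fun x => by
        simp [MeasurableEquiv.piFinSuccAbove_symm_apply, Fin.insertNthEquiv]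
      simp only [hcons]
      by_cases hy : y ∈ Set.Ioo 0 s
      · have hval : ∀ x : Fin n → ℝ, f (Fin.cons y x) = ENNReal.ofReal (y ^ (a 0 - 1)) *
            {x : Fin n → ℝ | (∀ i, 0 < x i) ∧ ∑ i, x i < s - y}.indicator (fun x =>
              ENNReal.ofReal ((∏ i, x i ^ (a i.succ - 1)) * (s - y - ∑ i, x i) ^ (b - 1))) x := by
          intro x
          by_cases hx : (∀ i, 0 < x i) ∧ ∑ i, x i < s - y
          · rw [hf, Set.indicator_of_mem, Set.indicator_of_mem (by exact hx),
              ← ENNReal.ofReal_mul (Real.rpow_nonneg hy.1.le _)]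
            · simp only [Fin.prod_univ_succ, Fin.sum_univ_succ, Fin.cons_zero, Fin.cons_succ]
              rw [mul_assoc, sub_sub]
            · refine ⟨fun i => ?_, ?_⟩
              · refine Fin.cases hy.1 (fun i => ?_) i
                exact hx.1 i
              · simp only [Fin.sum_univ_succ, Fin.cons_zero, Fin.cons_succ]
                linarith [hx.2]
          · rw [hf, Set.indicator_of_notMem, Set.indicator_of_notMem (by exact hx), mul_zero]
            rintro ⟨h1, h2⟩
            simp only [Fin.sum_univ_succ, Fin.cons_zero, Fin.cons_succ] at h2
            exact hx ⟨fun i => h1 i.succ, by linarith⟩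
        simp only [hval]
        rw [lintegral_const_mul' _ _ ENNReal.ofReal_ne_top,
          ih (fun i => a i.succ) (fun i => ha _) (sub_pos.2 hy.2), Set.indicator_of_mem hy,
          ← ENNReal.ofReal_mul (Real.rpow_nonneg hy.1.le _), ← ENNReal.ofReal_mul hC0]
        congr 1
        rw [← hpdef, ← hC]
        ring
      · have hval : ∀ x : Fin n → ℝ, f (Fin.cons y x) = 0 := by
          intro x
          refine Set.indicator_of_notMem ?_ _
          rintro ⟨h1, h2⟩
          simp only [Fin.sum_univ_succ, Fin.cons_zero, Fin.cons_succ] at h2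
          refine hy ⟨h1 0, ?_⟩
          have : 0 ≤ ∑ i, x i := Finset.sum_nonneg fun i _ => (h1 i.succ).le
          linarith
        simp only [hval, lintegral_zero, Set.indicator_of_notMem hy, mul_zero]
    simp only [hin]
    rw [lintegral_const_mul' _ _ ENNReal.ofReal_ne_top,
      lintegral_beta_scaled (ha 0) (by linarith) hs, ← ENNReal.ofReal_mul hC0]
    congr 1
    have hG := (Real.Gamma_pos_of_pos (show 0 < p + b by linarith)).ne'
    rw [Fin.sum_univ_succ, Fin.prod_univ_succ, ← hpdef, hC, beta, add_assoc (a 0) p b]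
    field_simp

theorem lintegral_dirichletPDF {n : ℕ} {α : Fin (n + 1) → ℝ} (hα : ∀ i, 0 < α i) :
    ∫⁻ x, dirichletPDF α x = 1 := by
  have hprod : 0 < ∏ i, Real.Gamma (α i) :=
    Finset.prod_pos fun i _ => Real.Gamma_pos_of_pos (hα i)
  have hsum : 0 < Real.Gamma (∑ i, α i) :=
    Real.Gamma_pos_of_pos (Finset.sum_pos (fun i _ => hα i) Finset.univ_nonempty)
  have h := lintegral_dirichlet (fun i : Fin n => α i.castSucc) (fun i => hα _)
    (hα (Fin.last n)) one_pos
  rw [← Fin.sum_univ_castSucc, ← Fin.prod_univ_castSucc (fun i => Real.Gamma (α i)),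
    Real.one_rpow, one_mul] at h
  have hpdf : ∀ x, dirichletPDF α x =
      ENNReal.ofReal (Real.Gamma (∑ i, α i) / ∏ i, Real.Gamma (α i)) *
        {x : Fin n → ℝ | (∀ i, 0 < x i) ∧ ∑ i, x i < 1}.indicator (fun x =>
          ENNReal.ofReal ((∏ i : Fin n, x i ^ (α i.castSucc - 1)) *
            (1 - ∑ i, x i) ^ (α (Fin.last n) - 1))) x := by
    intro x
    rw [dirichletPDF, Set.indicator_apply, Set.indicator_apply]
    split_ifs
    · rw [← ENNReal.ofReal_mul (by positivity)]
    · rw [mul_zero]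
  simp only [hpdf]
  rw [lintegral_const_mul' _ _ ENNReal.ofReal_ne_top, h, ← ENNReal.ofReal_mul (by positivity),
    div_mul_div_cancel₀ hprod.ne', div_self hsum.ne', ENNReal.ofReal_one]

end

/-! ### From uniform points under a graph to continuous densities, and the Dirichlet case -/

section

variable {m n : ℕ}

/-- The first coordinate of a uniform point of the region under the graph of a density is the
height, the others have this density. -/
theorem map_tail_restrict_subgraph (T : Set (Fin n → ℝ)) (ψ : (Fin n → ℝ) → ℝ)
    (h : MeasurableSet {z : Fin (n + 1) → ℝ |
      Fin.tail z ∈ T ∧ 0 < z 0 ∧ z 0 < ψ (Fin.tail z)}) :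
    (volume.restrict {z : Fin (n + 1) → ℝ |
      Fin.tail z ∈ T ∧ 0 < z 0 ∧ z 0 < ψ (Fin.tail z)}).map (fun z => Fin.tail z) =
        volume.withDensity (T.indicator fun x => ENNReal.ofReal (ψ x)) := by
  set R := {z : Fin (n + 1) → ℝ | Fin.tail z ∈ T ∧ 0 < z 0 ∧ z 0 < ψ (Fin.tail z)} with hR
  have htail : Measurable fun z : Fin (n + 1) → ℝ => (Fin.tail z : Fin n → ℝ) :=
    measurable_pi_lambda _ fun i => measurable_pi_apply i.succ
  ext B hB
  have hmp := (volume_preserving_piFinSuccAbove (fun _ : Fin (n + 1) => ℝ) 0).symm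
  have hm : MeasurableSet ((fun z : Fin (n + 1) → ℝ => (Fin.tail z : Fin n → ℝ)) ⁻¹' B ∩ R) :=
    (htail hB).inter h
  rw [Measure.map_apply htail hB, Measure.restrict_apply (htail hB), withDensity_apply _ hB,
    ← hmp.measure_preimage hm.nullMeasurableSet, Measure.volume_eq_prod,
    Measure.prod_apply_symm (MeasurableEquiv.measurable _ hm), ← lintegral_indicator hB]
  refine lintegral_congr fun x => ?_
  have hset : (fun y : ℝ => (y, x)) ⁻¹'
      ((MeasurableEquiv.piFinSuccAbove (fun _ : Fin (n + 1) => ℝ) 0).symm ⁻¹'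
        ((fun z : Fin (n + 1) → ℝ => (Fin.tail z : Fin n → ℝ)) ⁻¹' B ∩ R)) =
      {y | x ∈ B ∧ x ∈ T ∧ 0 < y ∧ y < ψ x} := by
    ext y
    simp [MeasurableEquiv.piFinSuccAbove_symm_apply, Fin.insertNthEquiv, hR]
  rw [hset]
  by_cases hxB : x ∈ B
  · rw [Set.indicator_of_mem hxB]
    by_cases hxT : x ∈ T
    · have : {y | x ∈ B ∧ x ∈ T ∧ 0 < y ∧ y < ψ x} = Set.Ioo 0 (ψ x) := by
        ext y
        simp [hxB, hxT]
      rw [this, Real.volume_Ioo, sub_zero, Set.indicator_of_mem hxT]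
    · simp [hxT]
  · simp [hxB]

/-- Every family of densities which is jointly continuous on an open set, and zero elsewhere, can be
sampled by an expression graph. -/
theorem exists_expressible_hasLaw_withDensity {W : Set ((Fin m → ℝ) × (Fin n → ℝ))}
    (hW : IsOpen W) {φ : (Fin m → ℝ) × (Fin n → ℝ) → ℝ} (hφ : ContinuousOn φ W)
    (hpos : ∀ q ∈ W, ∀ i, 0 ≤ q.2 i)
    (hint : ∀ θ : Fin m → ℝ, (∀ i, 0 < θ i ∧ θ i < 1) →
      ∫⁻ x, {x | (θ, x) ∈ W}.indicator (fun x => ENNReal.ofReal (φ (θ, x))) x = 1) :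
    ∃ X : (Fin (n + 1 + 1) → ℝ) × (Fin m → ℝ) → Fin n → ℝ,
      (∀ a, Expressible (unitInputs (n + 1 + 1) m) fun s => X s a) ∧
      ∀ θ : Fin m → ℝ, (∀ i, 0 < θ i ∧ θ i < 1) →
        HasLaw (fun u => X (u, θ))
          (volume.withDensity ({x | (θ, x) ∈ W}.indicator fun x => ENNReal.ofReal (φ (θ, x))))
          (uniformCube (n + 1 + 1)) := by
  let g : (Fin m → ℝ) × (Fin (n + 1) → ℝ) → (Fin m → ℝ) × (Fin n → ℝ) := fun q =>
    (q.1, Fin.tail q.2)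
  have hg : Continuous g := by
    refine continuous_fst.prodMk (continuous_pi fun i => ?_)
    exact (continuous_apply i.succ).comp continuous_snd
  have hz : Continuous fun q : (Fin m → ℝ) × (Fin (n + 1) → ℝ) => q.2 0 := by fun_prop
  -- The region under the density, with the height as coordinate 0. Joint continuity makes it open
  -- in θ and `z` together, and the extra coordinate keeps the dimension positive even for `n = 0`.
  let O : Set ((Fin m → ℝ) × (Fin (n + 1) → ℝ)) := {q | g q ∈ W ∧ 0 < q.2 0 ∧ q.2 0 < φ (g q)}
  have hO : IsOpen O := by
    have h1 : IsOpen ((g ⁻¹' W) ∩ (fun q => φ (g q) - q.2 0) ⁻¹' Set.Ioi 0) :=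
      ((hφ.comp hg.continuousOn fun q hq => hq).sub hz.continuousOn).isOpen_inter_preimage
        (hW.preimage hg) isOpen_Ioi
    have h2 : O = ((g ⁻¹' W) ∩ (fun q => φ (g q) - q.2 0) ⁻¹' Set.Ioi 0) ∩ {q | 0 < q.2 0} := by
      ext q
      simp only [O, Set.mem_inter_iff, Set.mem_preimage, Set.mem_Ioi, Set.mem_ofPred_eq, sub_pos]
      tauto
    rw [h2]
    exact h1.inter (isOpen_lt continuous_const hz)
  have htail : Measurable fun z : Fin (n + 1) → ℝ => (Fin.tail z : Fin n → ℝ) :=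
    measurable_pi_lambda _ fun i => measurable_pi_apply i.succ
  have hmap : ∀ θ, (volume.restrict {z | (θ, z) ∈ O}).map (fun z => Fin.tail z) =
      volume.withDensity ({x | (θ, x) ∈ W}.indicator fun x => ENNReal.ofReal (φ (θ, x))) :=
    fun θ => map_tail_restrict_subgraph {x | (θ, x) ∈ W} (fun x => φ (θ, x))
      (hO.preimage (by fun_prop : Continuous fun z : Fin (n + 1) → ℝ => (θ, z))).measurableSet
  obtain ⟨Z, hZ, hlaw⟩ := exists_expressible_hasLaw_restrict (Nat.succ_pos n) hO
    (fun θ _ z hzO i => by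
      refine Fin.cases hzO.2.1.le (fun i => ?_) i
      exact hpos _ hzO.1 i)
    -- The volume of the fibre is the total mass of its projection, which is the integral of the
    -- density.
    (fun θ hθ => by
      have := congrArg (fun μ => μ Set.univ) (hmap θ)
      simp only [Measure.map_apply htail MeasurableSet.univ, Set.preimage_univ,
        Measure.restrict_apply_univ, withDensity_apply _ MeasurableSet.univ,
        Measure.restrict_univ] at this
      rw [this, hint θ hθ])
  refine ⟨fun s => Fin.tail (Z s), fun a => hZ a.succ, fun θ hθ => ⟨?_, ?_⟩⟩
  · exact htail.comp_aemeasurable (hlaw θ hθ).aemeasurable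
  · have := AEMeasurable.map_map_of_aemeasurable (htail.aemeasurable) (hlaw θ hθ).aemeasurable
    rw [(hlaw θ hθ).map_eq, hmap] at this
    exact this.symm

theorem continuousOn_dirichletPDF (n : ℕ) : ContinuousOn
    (fun q : (Fin (n + 1) → ℝ) × (Fin n → ℝ) =>
      Real.Gamma (∑ i, q.1 i) / (∏ i, Real.Gamma (q.1 i)) *
        ((∏ i : Fin n, q.2 i ^ (q.1 i.castSucc - 1)) *
          (1 - ∑ i, q.2 i) ^ (q.1 (Fin.last n) - 1)))
    {q | (∀ i, 0 < q.1 i) ∧ (∀ i, 0 < q.2 i) ∧ ∑ i, q.2 i < 1} := by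
  rintro q ⟨hα, hx, hs⟩
  refine ContinuousAt.continuousWithinAt ?_
  have hΓ : ∀ y : ℝ, 0 < y → ContinuousAt Real.Gamma y := fun y hy =>
    (Real.differentiableAt_Gamma fun k => by
      have : (0 : ℝ) ≤ k := Nat.cast_nonneg k
      linarith).continuousAt
  have h1 : ContinuousAt (fun q : (Fin (n + 1) → ℝ) × (Fin n → ℝ) => Real.Gamma (∑ i, q.1 i)) q :=
    ContinuousAt.comp (f := fun q : (Fin (n + 1) → ℝ) × (Fin n → ℝ) => ∑ i, q.1 i)
      (hΓ _ (Finset.sum_pos (fun i _ => hα i) Finset.univ_nonempty)) (by fun_prop)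
  have h2 : ContinuousAt
      (fun q : (Fin (n + 1) → ℝ) × (Fin n → ℝ) => ∏ i, Real.Gamma (q.1 i)) q :=
    tendsto_finsetProd _ fun i _ =>
      ContinuousAt.comp (f := fun q : (Fin (n + 1) → ℝ) × (Fin n → ℝ) => q.1 i)
        (hΓ _ (hα i)) (by fun_prop)
  have h3 : ContinuousAt (fun q : (Fin (n + 1) → ℝ) × (Fin n → ℝ) =>
      ∏ i : Fin n, q.2 i ^ (q.1 i.castSucc - 1)) q :=
    tendsto_finsetProd _ fun i _ =>
      ContinuousAt.rpow (f := fun q : (Fin (n + 1) → ℝ) × (Fin n → ℝ) => q.2 i)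
        (g := fun q => q.1 i.castSucc - 1) (by fun_prop) (by fun_prop) (.inl (hx i).ne')
  have h4 : ContinuousAt (fun q : (Fin (n + 1) → ℝ) × (Fin n → ℝ) =>
      (1 - ∑ i, q.2 i) ^ (q.1 (Fin.last n) - 1)) q :=
    ContinuousAt.rpow (by fun_prop) (by fun_prop) (.inl (sub_pos.2 hs).ne')
  exact (h1.div h2 (Finset.prod_pos fun i _ => Real.Gamma_pos_of_pos (hα i)).ne').mul (h3.mul h4)

theorem isOpen_dirichlet_domain (n : ℕ) : IsOpen {q : (Fin (n + 1) → ℝ) × (Fin n → ℝ) |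
    (∀ i, 0 < q.1 i) ∧ (∀ i, 0 < q.2 i) ∧ ∑ i, q.2 i < 1} := by
  simp only [Set.ofPred_and, Set.ofPred_forall]
  refine IsOpen.inter ?_ (IsOpen.inter ?_ ?_)
  · exact isOpen_iInter_of_finite fun i => isOpen_lt continuous_const (by fun_prop)
  · exact isOpen_iInter_of_finite fun i => isOpen_lt continuous_const (by fun_prop)
  · exact isOpen_lt (by fun_prop) continuous_const

theorem exists_expressible_hasLaw_dirichletPDF (n : ℕ) :
    ∃ X : (Fin (n + 1 + 1) → ℝ) × (Fin (n + 1) → ℝ) → Fin n → ℝ,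
      (∀ a, Expressible (unitInputs (n + 1 + 1) (n + 1)) fun s => X s a) ∧
      ∀ α : Fin (n + 1) → ℝ, (∀ i, 0 < α i ∧ α i < 1) →
        HasLaw (fun u => X (u, α)) (volume.withDensity (dirichletPDF α))
          (uniformCube (n + 1 + 1)) := by
  have hpdf : ∀ α : Fin (n + 1) → ℝ, (∀ i, 0 < α i ∧ α i < 1) →
      {x : Fin n → ℝ | (α, x) ∈ {q : (Fin (n + 1) → ℝ) × (Fin n → ℝ) |
        (∀ i, 0 < q.1 i) ∧ (∀ i, 0 < q.2 i) ∧ ∑ i, q.2 i < 1}}.indicator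
          (fun x => ENNReal.ofReal (Real.Gamma (∑ i, α i) / (∏ i, Real.Gamma (α i)) *
            ((∏ i : Fin n, x i ^ (α i.castSucc - 1)) *
              (1 - ∑ i, x i) ^ (α (Fin.last n) - 1)))) = dirichletPDF α := by
    intro α hα
    rw [dirichletPDF]
    congr 1
    ext x
    simp [fun i => (hα i).1]
  obtain ⟨X, hX, hlaw⟩ := exists_expressible_hasLaw_withDensity (isOpen_dirichlet_domain n)
    (continuousOn_dirichletPDF n) (fun q hq i => (hq.2.1 i).le) fun α hα => by
      rw [← lintegral_dirichletPDF fun i => (hα i).1, ← hpdf α hα]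
  refine ⟨X, hX, fun α hα => ?_⟩
  rw [← hpdf α hα]
  exact hlaw α hα

end

end OneLiner

theorem mainTheorem4 (n : ℕ) :
    OneLiner.HasExtendedOneLiner {α : Fin (n + 1) → ℝ | ∀ i, 0 < α i ∧ α i < 1}
      OneLiner.dirichletMeasure := by
  open OneLiner in
  obtain ⟨X, hX, hlaw⟩ := exists_expressible_hasLaw_dirichletPDF n
  let c : (Fin n → ℝ) → Fin (n + 1) → ℝ := fun x => Fin.snoc (α := fun _ => ℝ) x (1 - ∑ i, x i)
  have hc : Measurable c := measurable_pi_lambda _ fun j => by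
    refine Fin.lastCases ?_ (fun j => ?_) j
    · simp only [c, Fin.snoc_last]
      fun_prop
    · simp only [c, Fin.snoc_castSucc]
      fun_prop
  have hF : ∀ j, Expressible (unitInputs (n + 1 + 1) (n + 1)) fun s => c (X s) j := fun j => by
    refine Fin.lastCases ?_ (fun j => ?_) j
    · simp only [c, Fin.snoc_last]
      exact .sub (.const 1) (.sum _ _ hX)
    · simp only [c, Fin.snoc_castSucc]
      exact hX j
  obtain ⟨N, D, out, hdef, heval⟩ := exists_dag_of_expressible _ hF
  refine ⟨n + 1 + 1, N, D, out, fun α hα => ⟨fun u hu => hdef (u, α) ⟨hu, hα⟩, ?_⟩⟩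
  -- The graph is known to compute the sampler only for inputs in the open cube, which has full
  -- measure.
  have hae : (fun u => c (X (u, α))) =ᵐ[uniformCube (n + 1 + 1)]
      fun u j => D.eval u α (out j) := by
    filter_upwards [ae_uniformCube (n + 1 + 1)] with u hu
    exact funext fun j => (heval (u, α) ⟨hu, hα⟩ j).symm
  have hm := hc.comp_aemeasurable (hlaw α hα).aemeasurable
  refine ⟨hm.congr hae, ?_⟩
  rw [← Measure.map_congr hae, dirichletMeasure, ← (hlaw α hα).map_eq]
  exact (AEMeasurable.map_map_of_aemeasurable hc.aemeasurable (hlaw α hα).aemeasurable).symm
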